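/- **Order book.** Fix $K,\bar M\in\mathbb N$, a horizon $T>0$, and boundary volumes $a_\infty,b_\infty\in\mathbb N\setminus\{0\}$; tick and order size are $1$. A state is $z=(x,y,\underline a,\underline b,\underline{na},\underline{nb},\underline{ra},\underline{rb},pa,pb)\in E:=\mathbb R\times\mathbb Z\times\mathbb N^K\times\mathbb N^K\times(\mathbb Z^{\bar M})^4\times\mathbb R\times\mathbb R$: the market maker's cash $x$ and inventory $y$; the numbers $a_i$ (resp. $b_i$) of shares offered (resp. bid) by the other participants $i$ ticks away from the best bid $pb$ (resp. best ask $pa$), $1\le i\le K$, all limits beyond the $K$-th one containing $a_\infty$ (resp. $b_\infty$) shares; the distance $ra_j$ (resp. $rb_j$) of the market maker's $j$-th sell (resp. buy) order from $pb$ (resp. $pa$), and its rank $na_j$ (resp. $nb_j$) in its queue, both being $-1$ if the order is not placed. Let $a_0$ be the least $i\le K$ with $a_i>0$ ($K+1$ if there is none), $|\underline a|+|\underline b|$ the total number of shares in the frame, and $|z|$ the Euclidean norm of $z$. The set $A_z$ of admissible actions consists of all $(\underline{ra}',\underline{rb}')$ with entries in $\{-1\}\cup\{a_0,\dots,K\}$.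 For $c\in A_z$, $\varphi^c(z)$ is the state after the market maker has moved her orders to the positions $c$: unmoved orders keep their place in the queue, the other ones are withdrawn and, if placed again, go to the end of their new queue. There are $4K+2$ types of events $e$: buy and sell market orders, and limit and cancel orders of the other participants at each of the $K$ limits of each side. A market order executes the first order in the queue at the best limit; if it belongs to the market maker, her cash and inventory change by $(+pa,-1)$ on the ask side and by $(-pb,+1)$ on the bid side. A limit order joins the end of its queue. A cancellation removes one of the other participants' orders of its queue, chosen uniformly (nothing happens if there is none). Ranks are updated according to the FIFO rule. When the best limit of a side moves by some ticks, so does the corresponding price, and the opposite side is re-indexed, vacant limits of the frame being filled with the boundary volume, and orders of the market maker that leave the frame being cancelled. The event $e$ has intensity $\lambda_e(\underline a,\underline b)\ge0$, independent of the market maker, and for some constants $\lambda^L,\lambda^C,\lambda^M$, $$\sum_i\lambda_{L_i^\pm}\le\lambda^L(|\underline a|+|\underline b|),\qquad \sum_i\lambda_{C_i^\pm}\le\lambda^C(|\underline a|+|\underline b|),\qquad \lambda_{M^+}+\lambda_{M^-}\le\lambda^M(|\underline a|+|\underline b|).$$ Let $\lambda(z)=\sum_e\lambda_e(\underline a,\underline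 b)$, and let $Q'(\cdot\mid z,c)$ be the law of the state right after the next event when the decision $c$ is taken in $z$ (the event is $e$ with probability $\lambda_e/\lambda$ and is applied to $\varphi^c(z)$). **Rewards.** The measurable running reward $f$ and terminal reward $g$ satisfy $|f(z,c)|\le c_5(1+|z|^2)$ for $z\in E$, $c\in A_z$, and $|g(z)|\le c_6(1+|z|^2)$ for $z\in E$. **Market making problem.** A strategy $\alpha$ chooses, at the initial time $T_0=t$ and at each jump time $T_n$, an action in $A_{Z_n}$ depending measurably on $(T_0,Z_0,\dots,T_n,Z_n)$, where $Z_n$ is the state reached at $T_n$; it is kept until the next jump, and $Z_s=\varphi^{\alpha_s}(Z_n)$ for $s\in[T_n,T_{n+1})$. Given the history, $T_{n+1}-T_n$ is exponential with parameter $\lambda(Z_n)$ ($T_{n+1}=\infty$ if $\lambda(Z_n)=0$) and, independently, $Z_{n+1}$ has law $Q'(\cdot\mid Z_n,\alpha_{T_n})$. For $(t,z)\in[0,T]\times E$, $$V(t,z)=\sup_\alpha\mathbb E^\alpha_{t,z}\Big[\int_t^Tf(Z_s,\alpha_s)\,ds+g(Z_T)\Big].$$ **Markov decision process.** For $(t,z)\in[0,T]\times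 E$ and $c\in A_z$ let $$r(t,z,c)=f(\varphi^c(z),c)\,\frac{1-e^{-\lambda(z)(T-t)}}{\lambda(z)}+e^{-\lambda(z)(T-t)}g(\varphi^c(z))$$ (the fraction is $T-t$ if $\lambda(z)=0$) and $$Q(B\times C\mid t,z,c)=\lambda(z)\int_0^{T-t}e^{-\lambda(z)s}\mathbf 1_B(t+s)\,Q'(C\mid z,c)\,ds,$$ the remaining mass $e^{-\lambda(z)(T-t)}$ being sent to a cemetery with zero reward. A policy is a sequence $(f_n)_{n\ge0}$ of measurable functions on $[0,T]\times E$ with $f_n(t,z)\in A_z$, and $$V_\infty(t,z)=\sup_{(f_n)}\mathbb E^{(f_n)}_{t,z}\Big[\sum_{n\ge0}r(T_n,Z_n,f_n(T_n,Z_n))\Big],\qquad(\mathcal Tv)(t,z)=\sup_{c\in A_z}\Big\{r(t,z,c)+\int v\,dQ(\cdot\mid t,z,c)\Big\}.$$ **Weighted space.** Let $\Lambda=(4K+2)\sup\lambda_e(\underline a,\underline b)/(|\underline a|+|\underline b|)$, the supremum being over all $e$ and all $(\underline a,\underline b)$ (with $0/0=0$). For $\gamma_0>0$ let $b(t,z)=(1+|z|^2)\,e^{\gamma(z)(T-t)}$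 with $\gamma(z)=\gamma_0(4K+2)\Lambda(1+|\underline a|+|\underline b|)$, and let $\mathbb B_b$ be the set of measurable $v:[0,T]\times E\to\mathbb R$ with $\|v\|_b=\sup_{(t,z)}|v(t,z)|/b(t,z)<\infty$. **Theorem.** For every $\gamma_0>0$, $\mathcal T$ has exactly one fixed point $v$ in $\mathbb B_b$. All the expectations above are well defined (the random variables being integrable, and $\mathbb E\sum_n|r(T_n,Z_n,f_n(T_n,Z_n))|<\infty$), the two suprema are finite, and $v=V_\infty=V$. There is a maximizer of $\mathcal T$ at $v$, i.e. a measurable $f^*$ with $f^*(t,z)\in A_z$ that attains the supremum in $(\mathcal Tv)(t,z)$ for all $(t,z)$; and for every such $f^*$ the stationary policy $(f^*,f^*,\dots)$ is optimal, for the Markov decision process and for the market making problem. -/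

import Mathlib

open MeasureTheory ProbabilityTheory
open scoped ENNReal NNReal

namespace LOB

/-! ## The order book -/

/-- One side (ask or bid) of the order book, as seen in the moving frame of `K` limits.
* `vol i` is the number of shares of the general participants `i + 1` ticks away from the best
  opposite price (`i = 0, …, K - 1`);
* `pos j` is the distance, in ticks, of the `j`-th order of the market maker from the best opposite
  price, `-1` if that order is not placed;
* `rank j` is the rank of this order in its queue (the first order in the queue has rank `1`), `-1`
  if it is not placed. -/
@[ext]
structure Side (K M : ℕ) where
  vol : Fin K → ℕ
  pos : Fin M → ℤ
  rank : Fin M → ℤ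

/-- The state `z` of the controlled order book: cash, inventory, the two sides and the best ask and
bid prices of the general participants. The tick size and the order size are `1`. -/
@[ext]
structure Book (K M : ℕ) where
  x : ℝ
  y : ℤ
  ask : Side K M
  bid : Side K M
  pa : ℝ
  pb : ℝ

/-- A decision: the positions of the sell orders and of the buy orders, `-1` for "not placed". -/
abbrev Action (M : ℕ) : Type := (Fin M → ℤ) × (Fin M → ℤ)

inductive BookSide
  | ask
  | bid

/-- The orders that the general participants may send to a given side of the book. The index
`i` stands for the limit `i + 1` ticks away from the best opposite price. -/
inductive Order (K : ℕ)
  | market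
  | limit (i : Fin K)
  | cancel (i : Fin K)

/-- The `4 K + 2` types of exogenous events. `(ask, market)` is a buy market order (it consumes the
ask side), `(bid, market)` a sell market order, `(ask, limit i)` a sell limit order, … -/
abbrev Event (K : ℕ) : Type := BookSide × Order K

def BookSide.equivBool : BookSide ≃ Bool where
  toFun s := match s with
    | .ask => true
    | .bid => false
  invFun b := match b with
    | true => .ask
    | false => .bid
  left_inv s := by cases s <;> rfl
  right_inv b := by cases b <;> rfl

def Order.equivSum (K : ℕ) : Order K ≃ Unit ⊕ (Fin K ⊕ Fin K) where
  toFun o := match o with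
    | .market => .inl ()
    | .limit i => .inr (.inl i)
    | .cancel i => .inr (.inr i)
  invFun o := match o with
    | .inl _ => .market
    | .inr (.inl i) => .limit i
    | .inr (.inr i) => .cancel i
  left_inv o := by cases o <;> rfl
  right_inv o := by rcases o with _ | _ | _ <;> rfl

instance : Fintype BookSide := Fintype.ofEquiv _ BookSide.equivBool.symm

instance (K : ℕ) : Fintype (Order K) := Fintype.ofEquiv _ (Order.equivSum K).symm

/-- The index of the first non-empty limit, between `1` and `K`; it is `K + 1` if the `K` limits
of the frame are empty (beyond the frame all limits are filled by the boundary condition). -/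
def best {K : ℕ} (v : Fin K → ℕ) : ℕ :=
  Nat.find (p := fun n => (∃ i : Fin K, n = (i : ℕ) + 1 ∧ 0 < v i) ∨ n = K + 1) ⟨K + 1, Or.inr rfl⟩

/-- The number of shares `l` ticks away from the best opposite price: `0` for `l ≤ 0`, the boundary
value `vinf` beyond the `K`-th limit. -/
def volAt {K : ℕ} (v : Fin K → ℕ) (vinf : ℕ) (l : ℤ) : ℕ :=
  if l ≤ 0 then 0 else if h : (l - 1).toNat < K then v ⟨(l - 1).toNat, h⟩ else vinf

namespace Side

variable {K M : ℕ}

/-- Re-indexing of a side when the best opposite price moves away by `d` ticks (comes closer by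
`-d` ticks if `d < 0`). The orders of the market maker that leave the frame are cancelled. -/
def shift (s : Side K M) (vinf : ℕ) (d : ℤ) : Side K M where
  vol i := volAt s.vol vinf ((i : ℤ) + 1 - d)
  pos j := if s.pos j ≠ -1 ∧ 1 ≤ s.pos j + d ∧ s.pos j + d ≤ K then s.pos j + d else -1
  rank j := if s.pos j ≠ -1 ∧ 1 ≤ s.pos j + d ∧ s.pos j + d ≤ K then s.rank j else -1

/-- A limit order of a general participant joins the end of the queue at limit `i + 1`. -/
def limitOrder (s : Side K M) (i : Fin K) : Side K M :=
  { s with vol := fun k => if k = i then s.vol k + 1 else s.vol k }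

/-- The number of orders of general participants in front of the `j`-th order of the market maker
in its queue. -/
def ahead (s : Side K M) (j : Fin M) : ℤ :=
  s.rank j - 1 - (Finset.univ.filter fun k => s.pos k = s.pos j ∧ s.rank k < s.rank j).card

/-- Cancellation of the order number `u` (`u = 0, 1, …`, counted from the front, among the general
participants' orders only) of the queue at limit `i + 1`. -/
def cancelOrder (s : Side K M) (i : Fin K) (u : ℕ) : Side K M :=
  if s.vol i = 0 then s else
    { vol := fun k => if k = i then s.vol k - 1 else s.vol k
      pos := s.pos
      rank := fun j => if s.pos j = (i : ℤ) + 1 ∧ (u : ℤ) < s.ahead j then s.rank j - 1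
        else s.rank j }

/-- The orders of the market maker that are executed by an incoming market order: those which are
first in the queue at the best limit. -/
def filled (s : Side K M) : Finset (Fin M) :=
  Finset.univ.filter fun j => s.pos j = best s.vol ∧ s.rank j = 1

/-- A market order executes the first order of the queue at the best limit. -/
def marketOrder (s : Side K M) : Side K M where
  vol k := if s.filled = ∅ ∧ (k : ℕ) + 1 = best s.vol then s.vol k - 1 else s.vol k
  pos j := if j ∈ s.filled then -1 else s.pos j
  rank j := if j ∈ s.filled then -1 else if s.pos j = best s.vol then s.rank j - 1 else s.rank j

/-- The market maker's `j`-th order stays in its queue under the decision `c`. -/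
def kept (s : Side K M) (c : Fin M → ℤ) (j : Fin M) : Prop := c j = s.pos j

instance (s : Side K M) (c : Fin M → ℤ) (j : Fin M) : Decidable (s.kept c j) :=
  inferInstanceAs (Decidable (c j = s.pos j))

/-- The market maker moves her orders to the positions `c`. An order whose position does not change
keeps its place in the queue (and advances when another order of hers in front of it is
withdrawn); the other ones are withdrawn, and sent to the end of the queue at their new position,
in the order of their indices. -/
def place (s : Side K M) (c : Fin M → ℤ) : Side K M where
  vol := s.vol
  pos := c
  rank j :=
    if c j = -1 then -1
    else if s.kept c j then
      s.rank j - (Finset.univ.filter fun k =>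
        ¬ s.kept c k ∧ s.pos k = s.pos j ∧ s.rank k < s.rank j).card
    else
      volAt s.vol 0 (c j) + (Finset.univ.filter fun k => c k = c j ∧ s.kept c k).card
        + (Finset.univ.filter fun k => c k = c j ∧ ¬ s.kept c k ∧ k < j).card + 1

end Side

/-- `|a| + |b|`: the total number of shares in the frame. -/
def size {K : ℕ} (a b : Fin K → ℕ) : ℕ := ∑ i, a i + ∑ i, b i

namespace Book

variable {K M : ℕ}

/-- `φ^c(z)`, the state of the book right after the decision `c`. -/
def place (c : Action M) (z : Book K M) : Book K M :=
  { z with ask := z.ask.place c.1, bid := z.bid.place c.2 }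

/-- `A_z`: each order is not placed, or is placed between the best limit and the limit `K`
(the market maker does not enter the spread). The spread is `best z.ask.vol`. -/
def admissible (z : Book K M) : Set (Action M) :=
  {c | (∀ j, c.1 j = -1 ∨ ((best z.ask.vol : ℤ) ≤ c.1 j ∧ c.1 j ≤ K)) ∧
    (∀ j, c.2 j = -1 ∨ ((best z.ask.vol : ℤ) ≤ c.2 j ∧ c.2 j ≤ K))}

/-- `|z|²`, the square of the Euclidean norm of the vector of all the coordinates of `z`. -/
noncomputable def normSq (z : Book K M) : ℝ :=
  z.x ^ 2 + (z.y : ℝ) ^ 2 + z.pa ^ 2 + z.pb ^ 2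
    + ∑ i, ((z.ask.vol i : ℝ) ^ 2 + (z.bid.vol i : ℝ) ^ 2)
    + ∑ j, ((z.ask.pos j : ℝ) ^ 2 + (z.bid.pos j : ℝ) ^ 2
        + (z.ask.rank j : ℝ) ^ 2 + (z.bid.rank j : ℝ) ^ 2)

/-- The side `s` of the book becomes `new`, and `n` orders of the market maker have been executed on
this side. If the best limit of the side has moved by `d` ticks, so does the best price of this
side, and the opposite side is re-indexed. -/
noncomputable def react (ainf binf : ℕ) (z : Book K M) (s : BookSide) (new : Side K M) (n : ℕ) :
    Book K M :=
  match s with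
  | .ask =>
    let d : ℤ := (best new.vol : ℤ) - best z.ask.vol
    { x := z.x + n * z.pa, y := z.y - n, ask := new, bid := z.bid.shift binf d,
      pa := z.pa + d, pb := z.pb }
  | .bid =>
    let d : ℤ := (best new.vol : ℤ) - best z.bid.vol
    { x := z.x - n * z.pb, y := z.y + n, ask := z.ask.shift ainf d, bid := new,
      pa := z.pa, pb := z.pb - d }

def side (z : Book K M) (s : BookSide) : Side K M :=
  match s with
  | .ask => z.ask
  | .bid => z.bid

/-- The state of the book after the event `e`; the mark `u` is used by the cancellations only
(rank of the cancelled order among those of the general participants). -/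
noncomputable def jump (ainf binf : ℕ) (e : Event K) (u : ℕ) (z : Book K M) : Book K M :=
  match e.2 with
  | .market => z.react ainf binf e.1 (z.side e.1).marketOrder (z.side e.1).filled.card
  | .limit i => z.react ainf binf e.1 ((z.side e.1).limitOrder i) 0
  | .cancel i => z.react ainf binf e.1 ((z.side e.1).cancelOrder i u) 0

/-- The number of possible marks of the event `e`: a cancellation concerns one of the orders of the
general participants in the queue. -/
def marks (e : Event K) (z : Book K M) : ℕ :=
  match e.2 with
  | .market => 1
  | .limit _ => 1
  | .cancel i => max 1 ((z.side e.1).vol i)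

end Book

/-! ## Measurable structure: the Borel `σ`-algebra of `ℝ³ × (countable discrete space)` -/

section Measurable

variable {K M : ℕ}

instance : MeasurableSpace (Side K M) := ⊤

instance : DiscreteMeasurableSpace (Side K M) := ⟨fun _ => trivial⟩

instance : Countable (Side K M) :=
  Function.Injective.countable
    (f := fun s : Side K M => (s.vol, s.pos, s.rank)) (by
      intro s t h
      simp only [Prod.mk.injEq] at h
      exact Side.ext h.1 h.2.1 h.2.2)

def Book.equivProd (K M : ℕ) : Book K M ≃ (ℝ × ℝ × ℝ) × (ℤ × Side K M × Side K M) where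
  toFun z := ((z.x, z.pa, z.pb), (z.y, z.ask, z.bid))
  invFun q := ⟨q.1.1, q.2.1, q.2.2.1, q.2.2.2, q.1.2.1, q.1.2.2⟩
  left_inv _ := rfl
  right_inv _ := rfl

instance : MeasurableSpace (Book K M) := MeasurableSpace.comap (Book.equivProd K M) inferInstance

def Book.measurableEquivProd (K M : ℕ) :
    Book K M ≃ᵐ (ℝ × ℝ × ℝ) × (ℤ × Side K M × Side K M) where
  toEquiv := Book.equivProd K M
  measurable_toFun := comap_measurable _
  measurable_invFun := by
    rintro _ ⟨t, ht, rfl⟩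
    simpa [← Set.preimage_comp] using ht

/-- Measurability on the state space can be checked with the discrete coordinates frozen. -/
theorem measurable_of_fibers {β : Type*} [MeasurableSpace β] {F : Book K M → β}
    (h : ∀ (y : ℤ) (a b : Side K M),
      Measurable fun q : ℝ × ℝ × ℝ => F ⟨q.1, y, a, b, q.2.1, q.2.2⟩) : Measurable F := by
  have h1 : Measurable (F ∘ (Book.measurableEquivProd K M).symm) :=
    measurable_from_prod_countable_left fun d => h d.1 d.2.1 d.2.2
  have h2 := h1.comp (Book.measurableEquivProd K M).measurable
  simpa [Function.comp_assoc] using h2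

theorem measurable_mk (y : ℤ) (a b : Side K M) {α : Type*} [MeasurableSpace α] {x p q : α → ℝ}
    (hx : Measurable x) (hp : Measurable p) (hq : Measurable q) :
    Measurable fun w => (⟨x w, y, a, b, p w, q w⟩ : Book K M) :=
  (Book.measurableEquivProd K M).symm.measurable.comp
    (f := fun w => ((x w, p w, q w), (y, a, b)))
    ((hx.prodMk (hp.prodMk hq)).prodMk measurable_const)

end Measurable

/-! ## The model -/

/-- The data of the market making problem: horizon, boundary conditions of the book, intensities of
the exogenous events (functions of the numbers of shares on the ask and bid sides), running and
terminal rewards. -/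
structure Model (K M : ℕ) where
  T : ℝ
  ainf : ℕ
  binf : ℕ
  lam : Event K → (Fin K → ℕ) → (Fin K → ℕ) → ℝ≥0
  f : Book K M → Action M → ℝ
  g : Book K M → ℝ

namespace Model

variable {K M : ℕ} (m : Model K M)

/-- The intensities are at most linear in `|a| + |b|`. -/
def LinearIntensities : Prop :=
  ∃ cL cC cM : ℝ, ∀ a b : Fin K → ℕ,
    (∀ s, ∑ i, (m.lam (s, .limit i) a b : ℝ) ≤ cL * size a b) ∧
    (∀ s, ∑ i, (m.lam (s, .cancel i) a b : ℝ) ≤ cC * size a b) ∧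
    ((m.lam (.ask, .market) a b : ℝ) + m.lam (.bid, .market) a b ≤ cM * size a b)

/-- The running and terminal rewards have at most quadratic growth in the state, uniformly in the
control. -/
def QuadraticRewards : Prop :=
  (∃ c, 0 < c ∧ ∀ z, ∀ a ∈ z.admissible, |m.f z a| ≤ c * (1 + z.normSq)) ∧
    ∃ c, 0 < c ∧ ∀ z, |m.g z| ≤ c * (1 + z.normSq)

/-- The total intensity `λ(z)` of the exogenous events. -/
noncomputable def rate (z : Book K M) : ℝ≥0 := ∑ e : Event K, m.lam e z.ask.vol z.bid.vol

/-- `Q'(· | z, c)`: the law of the state right after the next event, when the decision `c` is taken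
in the state `z`. The event `e` has probability `λ_e(z) / λ(z)`, and a cancellation concerns each of
the orders of the general participants in the queue with the same probability. -/
noncomputable def jumpGoal (z : Book K M) (c : Action M) : Measure (Book K M) :=
  ∑ e : Event K, ((m.lam e z.ask.vol z.bid.vol / m.rate z : ℝ≥0) : ℝ≥0∞) •
    ∑ u ∈ Finset.range ((z.place c).marks e),
      (((z.place c).marks e : ℝ≥0∞))⁻¹ • Measure.dirac ((z.place c).jump m.ainf m.binf e u)

/-- The state space `[0,T] × E` of the Markov decision process. -/
abbrev TState : Type := Set.Icc (0 : ℝ) m.T × Book K M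

/-- The law of the next jump time, restricted to `[0,T]`: density `λ e^{-λ(u-t)}` on `(t,T]`. -/
noncomputable def jumpTime (p : m.TState) : Measure (Set.Icc (0 : ℝ) m.T) :=
  (Measure.comap ((↑) : Set.Icc (0 : ℝ) m.T → ℝ) volume).withDensity fun u =>
    if p.1 < u then
      ENNReal.ofReal (m.rate p.2 * Real.exp (-(m.rate p.2 * ((u : ℝ) - p.1)))) else 0

/-- The transition kernel `Q(· | t, z, c)` on `[0,T] × E`. Its total mass is the probability that a
jump occurs before the horizon. -/
noncomputable def Q (p : m.TState) (c : Action M) : Measure m.TState :=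
  (m.jumpTime p).prod (m.jumpGoal p.2 c)

/-- `[0,T] × E` and a cemetery point, reached when no further jump occurs before the horizon. -/
abbrev XState : Type := m.TState ⊕ Unit

/-- One step of the chain: from `(t,z)` with decision `c`, jump according to `Q(· | t,z,c)`; with the
remaining probability `e^{-λ(z)(T-t)}` there is no jump before `T`. -/
noncomputable def step (p : m.TState) (c : Action M) : Measure m.XState :=
  (m.Q p c).map Sum.inl +
    ENNReal.ofReal (Real.exp (-(m.rate p.2 * (m.T - p.1)))) • Measure.dirac (Sum.inr ())

noncomputable def stepX (x : m.XState) (c : Action M) : Measure m.XState :=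
  match x with
  | .inl p => m.step p c
  | .inr _ => Measure.dirac (Sum.inr ())

/-! ### `stepX` is a Markov kernel -/

theorem measurable_rate : Measurable m.rate :=
  measurable_of_fibers fun y a b =>
    (measurable_const : Measurable fun _ => m.rate (⟨0, y, a, b, 0, 0⟩ : Book K M))

theorem measurable_jump (e : Event K) (u : ℕ) :
    Measurable fun z : Book K M => z.jump m.ainf m.binf e u := by
  refine measurable_of_fibers fun y a b => ?_
  rcases e with ⟨s, o⟩
  rcases s with _ | _ <;> rcases o with _ | i | i <;>
  · simp only [Book.jump, Book.react, Book.side]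
    apply measurable_mk <;> fun_prop

theorem measurable_place (c : Action M) : Measurable fun z : Book K M => z.place c := by
  refine measurable_of_fibers fun y a b => ?_
  simp only [Book.place]
  apply measurable_mk <;> fun_prop

theorem measurable_jumpGoal :
    Measurable fun q : m.TState × Action M => m.jumpGoal q.1.2 q.2 := by
  refine measurable_from_prod_countable_left fun c => ?_
  have h : Measurable fun z : Book K M => m.jumpGoal z c := by
    refine Measure.measurable_of_measurable_coe _ fun s hs => ?_
    refine measurable_of_fibers fun y a b => ?_
    have h1 : ∀ e u, Measurable fun q : ℝ × ℝ × ℝ =>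
        Measure.dirac (((⟨q.1, y, a, b, q.2.1, q.2.2⟩ : Book K M).place c).jump
          m.ainf m.binf e u) s := fun e u =>
      (Measure.measurable_coe hs).comp (Measure.measurable_dirac.comp
        ((m.measurable_jump e u).comp ((measurable_place c).comp
          (measurable_mk y a b (by fun_prop) (by fun_prop) (by fun_prop)))))
    have h2 : ∀ (e : Event K) (q : ℝ × ℝ × ℝ),
        ((⟨q.1, y, a, b, q.2.1, q.2.2⟩ : Book K M).place c).marks e =
          ((⟨0, y, a, b, 0, 0⟩ : Book K M).place c).marks e := by
      rintro ⟨_ | _, _ | _ | _⟩ q <;> rfl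
    have h3 : ∀ q : ℝ × ℝ × ℝ, m.rate (⟨q.1, y, a, b, q.2.1, q.2.2⟩ : Book K M) =
        m.rate (⟨0, y, a, b, 0, 0⟩ : Book K M) := fun _ => rfl
    simp only [jumpGoal, Measure.coe_finsetSum, Finset.sum_apply, Measure.smul_apply, smul_eq_mul,
      h2, h3]
    fun_prop (disch := exact h1 _ _)
  exact h.comp measurable_snd

instance : IsFiniteMeasure (Measure.comap ((↑) : Set.Icc (0 : ℝ) m.T → ℝ) volume) := by
  refine ⟨?_⟩
  rw [(MeasurableEmbedding.subtype_coe measurableSet_Icc).comap_apply, Set.image_univ,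
    Subtype.range_coe_subtype]
  exact measure_Icc_lt_top

theorem measurable_jumpTime : Measurable fun q : m.TState × Action M => m.jumpTime q.1 := by
  have hd : Measurable (Function.uncurry fun (p : m.TState) (u : Set.Icc (0 : ℝ) m.T) =>
      if p.1 < u then
        ENNReal.ofReal (m.rate p.2 * Real.exp (-(m.rate p.2 * ((u : ℝ) - p.1)))) else 0) := by
    have hr : Measurable fun q : m.TState × Set.Icc (0 : ℝ) m.T => (m.rate q.1.2 : ℝ) :=
      (m.measurable_rate.comp (measurable_snd.comp measurable_fst)).coe_nnreal_real
    refine Measurable.ite (measurableSet_lt (by fun_prop) (by fun_prop)) ?_ measurable_const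
    fun_prop
  have h : Measurable m.jumpTime := by
    refine Measure.measurable_of_measurable_coe _ fun s hs => ?_
    simp only [jumpTime, withDensity_apply _ hs]
    exact hd.lintegral_prod_right'
  exact h.comp measurable_fst

theorem jumpGoal_univ (z : Book K M) (c : Action M) (h : m.rate z ≠ 0) :
    m.jumpGoal z c Set.univ = 1 := by
  have hm : ∀ e, (((z.place c).marks e : ℕ) : ℝ≥0∞) ≠ 0 := by
    rintro ⟨_ | _, _ | _ | i⟩ <;> simp [Book.marks]
  have h1 : ∀ e : Event K, (((z.place c).marks e : ℕ) : ℝ≥0∞) *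
      (((z.place c).marks e : ℕ) : ℝ≥0∞)⁻¹ = 1 := fun e =>
    ENNReal.mul_inv_cancel (hm e) (ENNReal.natCast_ne_top _)
  simp only [jumpGoal, Measure.coe_finsetSum, Finset.sum_apply, Measure.smul_apply, smul_eq_mul,
    measure_univ, mul_one, Finset.sum_const, Finset.card_range, nsmul_eq_mul, h1]
  rw [← ENNReal.ofNNReal_finsetSum, ← Finset.sum_div]
  simp only [ENNReal.coe_eq_one]
  exact div_self h

theorem jumpTime_univ (p : m.TState) :
    m.jumpTime p Set.univ = ENNReal.ofReal (1 - Real.exp (-(m.rate p.2 * (m.T - p.1)))) := by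
  obtain ⟨⟨t, ht0, htT⟩, z⟩ := p
  generalize hl : (m.rate z : ℝ) = l
  have hl0 : 0 ≤ l := hl ▸ (m.rate z).2
  have hc : Continuous fun u : ℝ => l * Real.exp (-(l * (u - t))) := by fun_prop
  have h1 : ∫ u in t..m.T, l * Real.exp (-(l * (u - t))) = 1 - Real.exp (-(l * (m.T - t))) := by
    rw [intervalIntegral.integral_eq_sub_of_hasDerivAt
      (f := fun u => - Real.exp (-(l * (u - t)))) _ (hc.intervalIntegrable _ _)]
    · simp only [sub_self, mul_zero, neg_zero, Real.exp_zero]; ring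
    · intro u _
      have h : HasDerivAt (fun u => -(l * (u - t))) (-(l * 1)) u :=
        (((hasDerivAt_id u).sub_const t).const_mul l).neg
      have h' : HasDerivAt (fun u => -Real.exp (-(l * (u - t))))
        (-(Real.exp (-(l * (u - t))) * -(l * 1))) u := h.exp.neg
      exact h'.congr_deriv (by ring)
  have h2 : ∀ u : ℝ, (if t < u then ENNReal.ofReal (l * Real.exp (-(l * (u - t)))) else 0) =
      (Set.Ioi t).indicator (fun u => ENNReal.ofReal (l * Real.exp (-(l * (u - t))))) u := by
    intro u; simp [Set.indicator_apply]
  have h3 : Set.Icc 0 m.T ∩ Set.Ioi t = Set.Ioc t m.T := by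
    ext u; simp only [Set.mem_inter_iff, Set.mem_Icc, Set.mem_Ioi, Set.mem_Ioc]
    constructor
    · rintro ⟨⟨_, h⟩, h'⟩; exact ⟨h', h⟩
    · rintro ⟨h', h⟩; exact ⟨⟨ht0.trans h'.le, h⟩, h'⟩
  rw [jumpTime, withDensity_apply _ MeasurableSet.univ, Measure.restrict_univ]
  simp only [hl, ← Subtype.coe_lt_coe]
  rw [lintegral_subtype_comap measurableSet_Icc
    (fun u : ℝ => if t < u then ENNReal.ofReal (l * Real.exp (-(l * (u - t)))) else 0)]
  simp only [h2]
  rw [setLIntegral_indicator measurableSet_Ioi, Set.inter_comm, h3, ← h1,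
    intervalIntegral.integral_of_le htT, ofReal_integral_eq_lintegral_ofReal]
  · exact (hc.integrableOn_Icc).mono_set Set.Ioc_subset_Icc_self
  · exact Filter.Eventually.of_forall fun u => mul_nonneg hl0 (Real.exp_pos _).le

theorem jumpGoal_univ_le (z : Book K M) (c : Action M) : m.jumpGoal z c Set.univ ≤ 1 := by
  by_cases h : m.rate z = 0
  · simp [jumpGoal, h]
  · exact (m.jumpGoal_univ z c h).le

theorem jumpTime_univ_le (p : m.TState) : m.jumpTime p Set.univ ≤ 1 := by
  rw [jumpTime_univ, ← ENNReal.ofReal_one]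
  exact ENNReal.ofReal_le_ofReal (by linarith [Real.exp_pos (-(m.rate p.2 * (m.T - p.1)))])

instance (z : Book K M) (c : Action M) : IsFiniteMeasure (m.jumpGoal z c) :=
  ⟨(m.jumpGoal_univ_le z c).trans_lt ENNReal.one_lt_top⟩

instance (p : m.TState) : IsFiniteMeasure (m.jumpTime p) :=
  ⟨(m.jumpTime_univ_le p).trans_lt ENNReal.one_lt_top⟩

theorem measurable_Q : Measurable fun q : m.TState × Action M => m.Q q.1 q.2 := by
  let k₁ : Kernel (m.TState × Action M) (Set.Icc (0 : ℝ) m.T) := ⟨_, m.measurable_jumpTime⟩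
  let k₂ : Kernel (m.TState × Action M) (Book K M) := ⟨_, m.measurable_jumpGoal⟩
  have : IsFiniteKernel k₁ := ⟨1, ENNReal.one_lt_top, fun q => m.jumpTime_univ_le q.1⟩
  have : IsFiniteKernel k₂ := ⟨1, ENNReal.one_lt_top, fun q => m.jumpGoal_univ_le q.1.2 q.2⟩
  have h := (k₁ ×ₖ k₂).measurable
  convert h using 2 with q
  rw [Kernel.prod_apply]
  rfl

theorem measurable_stepX : Measurable fun q : m.XState × Action M => m.stepX q.1 q.2 := by
  have h : Measurable (Sum.elim (fun q : m.TState × Action M => m.step q.1 q.2)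
      (fun _ : Unit × Action M => (Measure.dirac (Sum.inr ()) : Measure m.XState))) := by
    refine Measurable.sumElim ?_ measurable_const
    refine Measure.measurable_of_measurable_coe _ fun s hs => ?_
    have hr : Measurable fun q : m.TState × Action M => (m.rate q.1.2 : ℝ) :=
      (m.measurable_rate.comp (measurable_snd.comp measurable_fst)).coe_nnreal_real
    simp only [step, Measure.add_apply, Measure.smul_apply, smul_eq_mul,
      Measure.map_apply measurable_inl hs]
    refine Measurable.add ?_ ?_
    · exact (Measure.measurable_coe (measurable_inl hs)).comp m.measurable_Q
    · fun_prop
  have h2 := h.comp (MeasurableEquiv.sumProdDistrib m.TState Unit (Action M)).measurable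
  convert h2 using 1
  funext ⟨x, c⟩
  rcases x with p | u <;> rfl

theorem isProbabilityMeasure_stepX (x : m.XState) (c : Action M) :
    IsProbabilityMeasure (m.stepX x c) := by
  rcases x with p | u
  · refine ⟨?_⟩
    simp only [stepX, step, Measure.add_apply, Measure.smul_apply, smul_eq_mul,
      Measure.map_apply measurable_inl MeasurableSet.univ, Set.preimage_univ, measure_univ, mul_one,
      Q]
    rw [← Set.univ_prod_univ, Measure.prod_prod]
    have hT : 0 ≤ m.T - p.1 := sub_nonneg.2 p.1.2.2
    by_cases h : m.rate p.2 = 0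
    · simp [jumpGoal, h]
    · rw [m.jumpGoal_univ _ _ h, mul_one, jumpTime_univ, ← ENNReal.ofReal_add]
      · simp
      · simp only [sub_nonneg, Real.exp_le_one_iff, neg_nonpos]
        positivity
      · positivity
  · exact inferInstanceAs (IsProbabilityMeasure (Measure.dirac _))

/-! ## Strategies and the controlled process -/

/-- The histories `(T₀, Z₀, …, Tₙ, Zₙ)`. -/
abbrev Hist (n : ℕ) : Type := Finset.Iic n → m.XState

/-- An admissible strategy of the market maker: the decision taken at the `n`-th jump time, and kept
until the next one, is an admissible action that depends measurably on the history up to then. -/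
structure Strategy where
  act : ∀ n, m.Hist n → Action M
  measurable_act : ∀ n, Measurable (act n)
  admissible : ∀ n (h : m.Hist n) (p : m.TState),
    h ⟨n, Finset.mem_Iic.2 le_rfl⟩ = Sum.inl p → act n h ∈ p.2.admissible

/-- A decision function `f : [0,T] × E → A`. -/
structure DecisionRule where
  act : m.TState → Action M
  measurable_act : Measurable act
  admissible : ∀ p, act p ∈ p.2.admissible

/-- A policy of the Markov decision process: a sequence `(f₀, f₁, …)` of decision functions. -/
abbrev Policy : Type := ℕ → m.DecisionRule

/-- The strategy given by a policy: the decision at the `n`-th jump is `fₙ(Tₙ, Zₙ)`. (The value at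
the cemetery plays no role.) -/
def Policy.toStrategy {m : Model K M} (F : m.Policy) : m.Strategy where
  act n h := Sum.elim (F n).act (fun _ => (fun _ => -1, fun _ => -1))
    (h ⟨n, Finset.mem_Iic.2 le_rfl⟩)
  measurable_act n :=
    (Measurable.sumElim (F n).measurable_act measurable_const).comp (measurable_pi_apply _)
  admissible n h p hp := by
    simp only [hp, Sum.elim_inl]
    exact (F n).admissible p

/-- The conditional law of the `(n+1)`-th state given the history. -/
noncomputable def kernel (π : m.Strategy) (n : ℕ) : Kernel (m.Hist n) m.XState where
  toFun h := m.stepX (h ⟨n, Finset.mem_Iic.2 le_rfl⟩) (π.act n h)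
  measurable' := m.measurable_stepX.comp
    (f := fun h : m.Hist n => (h ⟨n, Finset.mem_Iic.2 le_rfl⟩, π.act n h))
    ((measurable_pi_apply _).prodMk (π.measurable_act n))

instance (π : m.Strategy) (n : ℕ) : IsMarkovKernel (m.kernel π n) :=
  ⟨fun _ => m.isProbabilityMeasure_stepX _ _⟩

/-- The law, under the strategy `π`, of the sequence `(Tₙ, Zₙ)` of the jump times and states of the
order book started at `p = (t,z)` (with value the cemetery if there are less than `n` jumps up to
`T`). -/
noncomputable def law (π : m.Strategy) (p : m.TState) : Measure (ℕ → m.XState) :=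
  Kernel.traj (X := fun _ => m.XState) (m.kernel π) 0 (fun _ => Sum.inl p)

/-! ## The market making problem in continuous time -/

/-- The number of jumps up to the time `s`: the first `n` such that the `(n+1)`-th jump, if there is
any, is after `s`. -/
noncomputable def jumpCount (ω : ℕ → m.XState) (s : ℝ) : ℕ :=
  sInf {n | ∀ q : m.TState, ω (n + 1) = Sum.inl q → s < q.1}

/-- The decision in force at the time `s`. -/
noncomputable def control (π : m.Strategy) (ω : ℕ → m.XState) (s : ℝ) : Action M :=
  π.act (m.jumpCount ω s) fun i => ω i

/-- `k` evaluated at the state `Z_s = φ^{α_s}(Z_n)`, `n` being the number of jumps up to `s`. -/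
noncomputable def evalAt (π : m.Strategy) (ω : ℕ → m.XState) (s : ℝ) (k : Book K M → ℝ) : ℝ :=
  match ω (m.jumpCount ω s) with
  | .inl q => k (q.2.place (m.control π ω s))
  | .inr _ => 0

/-- `∫ₜᵀ f(Z_s, α_s) ds + g(Z_T)`. -/
noncomputable def gain (π : m.Strategy) (p : m.TState) (ω : ℕ → m.XState) : ℝ :=
  (∫ s in (p.1 : ℝ)..m.T, m.evalAt π ω s fun z => m.f z (m.control π ω s))
    + m.evalAt π ω m.T m.g

/-- The expected gain of the strategy `π` from `p = (t,z)`. -/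
noncomputable def expectedGain (π : m.Strategy) (p : m.TState) : ℝ :=
  ∫ ω, m.gain π p ω ∂(m.law π p)

/-- The value function `V` of the market making problem. -/
noncomputable def V (p : m.TState) : ℝ := ⨆ π : m.Strategy, m.expectedGain π p

/-! ## The Markov decision process -/

/-- `(1 - e^{-λτ}) / λ`, read as `τ` for `λ = 0`: the mean of `min(τ, S)` for `S` exponential. -/
noncomputable def meanSojourn (l τ : ℝ) : ℝ :=
  if l = 0 then τ else 1 / l - Real.exp (-(l * τ)) / l

/-- The one-stage reward `r(t,z,c)`. -/
noncomputable def r (p : m.TState) (c : Action M) : ℝ :=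
  m.f (p.2.place c) c * meanSojourn (m.rate p.2) (m.T - p.1)
    + Real.exp (-(m.rate p.2 * (m.T - p.1))) * m.g (p.2.place c)

/-- The reward `r(Tₙ, Zₙ, fₙ(Tₙ, Zₙ))`, zero when the horizon has been reached before. -/
noncomputable def stageReward (F : m.Policy) (n : ℕ) (ω : ℕ → m.XState) : ℝ :=
  Sum.elim (fun q => m.r q ((F n).act q)) (fun _ => 0) (ω n)

/-- The cumulated reward functional of the policy `F`. -/
noncomputable def mdpReward (F : m.Policy) (p : m.TState) : ℝ :=
  ∫ ω, ∑' n, m.stageReward F n ω ∂(m.law F.toStrategy p)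

/-- The value function `V_∞` of the Markov decision process. -/
noncomputable def Vinf (p : m.TState) : ℝ := ⨆ F : m.Policy, m.mdpReward F p

/-- `r(t,z,c) + ∫ v dQ(· | t,z,c)`. -/
noncomputable def actionValue (v : m.TState → ℝ) (p : m.TState) (c : Action M) : ℝ :=
  m.r p c + ∫ q, v q ∂(m.Q p c)

/-- The maximal reward operator. -/
noncomputable def bellman (v : m.TState → ℝ) (p : m.TState) : ℝ :=
  ⨆ c : p.2.admissible, m.actionValue v p c

/-- `f` is a maximizer of the maximal reward operator at `v`. -/
def IsMaximizer (v : m.TState → ℝ) (F : m.DecisionRule) : Prop :=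
  ∀ p, m.actionValue v p (F.act p) = m.bellman v p

/-! ## The weighted norm -/

/-- `Λ`, `4 K + 2` times the supremum of the intensities divided by `|a| + |b|`. -/
noncomputable def Lam : ℝ :=
  (4 * K + 2) * ⨆ q : Event K × (Fin K → ℕ) × (Fin K → ℕ),
    (m.lam q.1 q.2.1 q.2.2 : ℝ) / size q.2.1 q.2.2

/-- The bounding function `b(t,z) = (1 + |z|²) e^{γ(z)(T-t)}` with
`γ(z) = γ₀ (4 K + 2) Λ (1 + |a| + |b|)`. -/
noncomputable def bound (γ₀ : ℝ) (p : m.TState) : ℝ :=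
  (1 + p.2.normSq) * Real.exp
    (γ₀ * (4 * K + 2) * m.Lam * (1 + size p.2.ask.vol p.2.bid.vol) * (m.T - p.1))

/-- The measurable functions with finite weighted supremum norm. -/
def weightedSpace (γ₀ : ℝ) : Set (m.TState → ℝ) :=
  {v | Measurable v ∧ BddAbove (Set.range fun p => |v p| / m.bound γ₀ p)}

end Model

end LOB

/-!
The proof rests on a weight `W` of the form `G(z) * exp (ρ t * (1 + |a| + |b|))`. A jump adds at
most a bounded number of shares to the frame, so it multiplies `W` by at most a constant factor,
whereas the event rate is linear in `|a| + |b|`: if `ρ` decreases fast enough in `t`, then `W` is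
contracted by `Q` with a factor `κ < 1`, and it can be chosen below a multiple of the bound `b`.

As `W` dominates the rewards, `𝒯` is a contraction for the norm weighted by `W`. Iterating the
contraction along the chain makes all series of rewards converge in mean, and telescoping
`v(Tₙ, Zₙ)` shows that a strategy falls short of the fixed point `v` by the expected sum of the
losses `(𝒯v - (r + Qv))(Tₙ, Zₙ, αₙ) ≥ 0`. Almost surely only finitely many jumps occur, the gain in
continuous time is the sum of the gains collected between them, and the conditional means of the
latter are the `r(Tₙ, Zₙ, αₙ)`: both control problems have the same value.

The bound `b` itself need not be contracted, its exponent `γ₀` being arbitrary. On a short time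
slice, however, a steep `ρ` gives a contracted weight which dominates `b`, so two fixed points in
the weighted space agree slice by slice, backward from the horizon.
-/

namespace LOB

/-! ## One-step growth of the order book -/

section Growth

variable {K M : ℕ}

theorem best_le (v : Fin K → ℕ) : best v ≤ K + 1 := Nat.find_min' _ (Or.inr rfl)

theorem one_le_best (v : Fin K → ℕ) : 1 ≤ best v := by
  have hspec : (∃ i : Fin K, best v = (i : ℕ) + 1 ∧ 0 < v i) ∨ best v = K + 1 :=
    Nat.find_spec (p := fun n => (∃ i : Fin K, n = (i : ℕ) + 1 ∧ 0 < v i) ∨ n = K + 1)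
      ⟨K + 1, Or.inr rfl⟩
  rcases hspec with ⟨i, hi, -⟩ | h <;> omega

theorem abs_best_sub_best_le (v w : Fin K → ℕ) : |(best v : ℤ) - best w| ≤ K := by
  have := best_le v
  have := best_le w
  have := one_le_best v
  have := one_le_best w
  rw [abs_le]
  omega

theorem volAt_le (v : Fin K → ℕ) (vinf : ℕ) (l : ℤ) :
    volAt v vinf l ≤ vinf + ∑ k : Fin K, if (k : ℤ) + 1 = l then v k else 0 := by
  unfold volAt
  split_ifs with hl hK
  · exact Nat.zero_le _
  · have hterm := Finset.single_le_sum (f := fun k : Fin K => if (k : ℤ) + 1 = l then v k else 0)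
      (fun _ _ => Nat.zero_le _) (Finset.mem_univ ⟨(l - 1).toNat, hK⟩)
    have hindex : (((l - 1).toNat : ℕ) : ℤ) + 1 = l := by omega
    simp only [hindex, if_true] at hterm
    omega
  · omega

theorem volAt_zero_le (v : Fin K → ℕ) (l : ℤ) : volAt v 0 l ≤ ∑ k, v k := by
  refine (volAt_le v 0 l).trans ?_
  rw [zero_add]
  refine Finset.sum_le_sum fun k _ => ?_
  split_ifs <;> simp

theorem sum_volAt_le (v : Fin K → ℕ) (vinf : ℕ) (d : ℤ) :
    ∑ i : Fin K, volAt v vinf ((i : ℤ) + 1 - d) ≤ K * vinf + ∑ k, v k := by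
  refine (Finset.sum_le_sum fun i _ => volAt_le v vinf _).trans ?_
  rw [Finset.sum_add_distrib, Finset.sum_comm]
  simp only [Finset.sum_const, Finset.card_univ, Fintype.card_fin, smul_eq_mul]
  gcongr with k
  rw [← Finset.sum_filter, Finset.sum_const, smul_eq_mul]
  refine mul_le_of_le_one_left' (Finset.card_le_one.2 fun i hi j hj => ?_)
  simp only [Finset.mem_filter, Finset.mem_univ, true_and] at hi hj
  ext
  omega

theorem card_filter_fin_le (P : Fin M → Prop) [DecidablePred P] :
    (Finset.univ.filter P).card ≤ M :=
  (Finset.card_le_univ _).trans_eq (Fintype.card_fin M)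

namespace Side

/-- `t` is reached from `s` by a bounded number of moves of the market: the volume and the positions
grow by at most the constant `B`. A rank may also grow by the length of a queue, hence its
dependence on the volume. -/
structure Near (B : ℕ) (s t : Side K M) : Prop where
  vol : ∑ i, t.vol i ≤ ∑ i, s.vol i + B
  pos : ∀ j, |t.pos j| ≤ |s.pos j| + B
  rank : ∀ j, |t.rank j| ≤ |s.rank j| + B * (1 + ∑ i, s.vol i : ℕ)

theorem Near.mono {B B' : ℕ} {s t : Side K M} (h : s.Near B t) (hB : B ≤ B') : s.Near B' t where
  vol := h.vol.trans (by gcongr)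
  pos j := (h.pos j).trans (by gcongr)
  rank j := (h.rank j).trans (by gcongr)

theorem Near.trans {B B' : ℕ} {s t u : Side K M} (hst : s.Near B t) (htu : t.Near B' u) :
    s.Near (B + B' + B * B') u where
  vol := by have := hst.vol; have := htu.vol; nlinarith
  pos j := by
    have := hst.pos j
    have := htu.pos j
    push_cast
    nlinarith
  rank j := by
    have hvol : (B' : ℤ) * (1 + ∑ i, t.vol i : ℕ) ≤ B' * (1 + (∑ i, s.vol i + B) : ℕ) := by
      gcongr
      exact hst.vol
    have hrank : 0 ≤ (B' : ℤ) * B * (∑ i, s.vol i : ℕ) := by positivity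
    have := hst.rank j
    have := htu.rank j
    push_cast at *
    linarith

theorem near_limitOrder (s : Side K M) (i : Fin K) : s.Near 1 (s.limitOrder i) where
  vol := by
    have hvol : ∀ k, (s.limitOrder i).vol k = s.vol k + if k = i then 1 else 0 := fun k => by
      simp only [limitOrder]; split_ifs <;> rfl
    simp [hvol, Finset.sum_add_distrib]
  pos j := by simp [limitOrder]
  rank j := by simp only [limitOrder]; omega

theorem near_cancelOrder (s : Side K M) (i : Fin K) (u : ℕ) : s.Near 1 (s.cancelOrder i u) := by
  unfold cancelOrder
  split_ifs with h
  · exact ⟨by omega, fun j => by omega, fun j => by omega⟩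
  · refine ⟨Nat.le_succ_of_le (Finset.sum_le_sum fun k _ => ?_), fun j => by simp, fun j => ?_⟩
    · dsimp only; split_ifs <;> omega
    · dsimp only; split_ifs <;> grind

theorem near_marketOrder (s : Side K M) : s.Near 1 s.marketOrder where
  vol := by
    refine Nat.le_succ_of_le (Finset.sum_le_sum fun k _ => ?_)
    simp only [marketOrder]; split_ifs <;> omega
  pos j := by simp only [marketOrder]; split_ifs <;> grind
  rank j := by simp only [marketOrder]; split_ifs <;> grind

theorem near_shift (s : Side K M) (vinf : ℕ) (d : ℤ) :
    s.Near (K * vinf + K + 1) (s.shift vinf d) where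
  vol := by
    have := sum_volAt_le s.vol vinf d
    simp only [shift]
    omega
  pos j := by simp only [shift]; split_ifs <;> grind
  rank j := by
    have : 0 ≤ ((K * vinf + K : ℕ) : ℤ) * (1 + ∑ i, s.vol i : ℕ) := by positivity
    simp only [shift]
    split_ifs <;> grind

theorem near_place (s : Side K M) {c : Fin M → ℤ} (hc : ∀ j, |c j| ≤ K + 1) :
    s.Near (K + 2 * M + 1) (s.place c) where
  vol := by simp only [place]; omega
  pos j := by have := hc j; simp only [place]; grind
  rank j := by
    suffices h : |(s.place c).rank j| ≤ |s.rank j| + (∑ i, s.vol i : ℕ) + (2 * M + 1) by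
      refine h.trans ?_
      have : 0 ≤ ((K + 2 * M : ℕ) : ℤ) * (∑ i, s.vol i : ℕ) := by positivity
      push_cast at *
      linarith
    have := abs_nonneg (s.rank j)
    simp only [place]
    split_ifs
    · simp only [abs_neg, abs_one]; omega
    · have := card_filter_fin_le
        fun k => ¬ s.kept c k ∧ s.pos k = s.pos j ∧ s.rank k < s.rank j
      grind
    · have := card_filter_fin_le fun k => c k = c j ∧ s.kept c k
      have := card_filter_fin_le fun k => c k = c j ∧ ¬ s.kept c k ∧ k < j
      have := volAt_zero_le s.vol (c j)
      rw [abs_of_nonneg (by positivity)]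
      omega

end Side

namespace Book

/-- `w` is reached from `z` by a bounded number of moves of the market, each of which changes the
cash of the market maker by at most a multiple of the prices. -/
structure Near (B : ℕ) (z w : Book K M) : Prop where
  x : |w.x| ≤ |z.x| + B * (1 + |z.pa| + |z.pb|)
  y : |w.y| ≤ |z.y| + B
  ask : z.ask.Near B w.ask
  bid : z.bid.Near B w.bid
  pa : |w.pa| ≤ |z.pa| + B
  pb : |w.pb| ≤ |z.pb| + B

theorem Near.mono {B B' : ℕ} {z w : Book K M} (h : z.Near B w) (hB : B ≤ B') : z.Near B' w where
  x := h.x.trans (by gcongr)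
  y := h.y.trans (by gcongr)
  ask := h.ask.mono hB
  bid := h.bid.mono hB
  pa := h.pa.trans (by gcongr)
  pb := h.pb.trans (by gcongr)

theorem Near.trans {B B' : ℕ} {z w q : Book K M} (hzw : z.Near B w) (hwq : w.Near B' q) :
    z.Near (B + B' + 2 * B * B') q where
  x := by
    have hprices : (B' : ℝ) * (1 + |w.pa| + |w.pb|) ≤
        B' * (1 + (|z.pa| + B) + (|z.pb| + B)) := by
      gcongr
      exacts [hzw.pa, hzw.pb]
    have : 0 ≤ (2 * B * B' : ℝ) * (|z.pa| + |z.pb|) := by positivity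
    have := hzw.x
    have := hwq.x
    push_cast
    linarith
  y := by have := hzw.y; have := hwq.y; push_cast; nlinarith
  ask := (hzw.ask.trans hwq.ask).mono (by nlinarith)
  bid := (hzw.bid.trans hwq.bid).mono (by nlinarith)
  pa := by
    have : 0 ≤ (2 * B * B' : ℝ) := by positivity
    have := hzw.pa
    have := hwq.pa
    push_cast
    linarith
  pb := by
    have : 0 ≤ (2 * B * B' : ℝ) := by positivity
    have := hzw.pb
    have := hwq.pb
    push_cast
    linarith

theorem abs_le_of_mem_admissible {z : Book K M} {c : Action M} (hc : c ∈ z.admissible) :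
    (∀ j, |c.1 j| ≤ (K : ℤ) + 1) ∧ ∀ j, |c.2 j| ≤ (K : ℤ) + 1 := by
  have := one_le_best z.ask.vol
  refine ⟨fun j => ?_, fun j => ?_⟩
  · rcases hc.1 j with h | h <;> rw [abs_le] <;> omega
  · rcases hc.2 j with h | h <;> rw [abs_le] <;> omega

theorem near_place {z : Book K M} {c : Action M} (hc : c ∈ z.admissible) :
    z.Near (K + 2 * M + 1) (z.place c) where
  x := le_add_of_nonneg_right (by positivity)
  y := le_add_of_nonneg_right (by positivity)
  ask := z.ask.near_place (abs_le_of_mem_admissible hc).1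
  bid := z.bid.near_place (abs_le_of_mem_admissible hc).2
  pa := le_add_of_nonneg_right (by positivity)
  pb := le_add_of_nonneg_right (by positivity)

theorem near_react (ainf binf : ℕ) (z : Book K M) (s : BookSide) {new : Side K M} {n : ℕ}
    (hn : n ≤ M) (hnew : (z.side s).Near 1 new) :
    z.Near (K * (ainf + binf) + K + M + 1) (z.react ainf binf s new n) := by
  set B := K * (ainf + binf) + K + M + 1 with hB
  rw [mul_add] at hB
  have hnB : (n : ℝ) ≤ B := by exact_mod_cast (by omega : n ≤ B)
  have hKB : (K : ℝ) ≤ B := by exact_mod_cast (by omega : K ≤ B)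
  have hcash (p q : ℝ) : |n * p| ≤ B * (1 + |p| + |q|) := by
    rw [abs_mul, Nat.abs_cast]
    gcongr
    linarith [abs_nonneg q]
  have hprice (v w : Fin K → ℕ) : |(((best v : ℤ) - best w : ℤ) : ℝ)| ≤ B :=
    le_trans (by exact_mod_cast abs_best_sub_best_le v w) hKB
  cases s with
  | ask =>
    exact
      { x := (abs_add_le _ _).trans (by gcongr; exact hcash _ _)
        y := (abs_sub _ _).trans (by rw [Nat.abs_cast]; omega)
        ask := hnew.mono (by omega)
        bid := (z.bid.near_shift _ _).mono (by omega)
        pa := (abs_add_le _ _).trans (by gcongr; exact hprice _ _)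
        pb := le_add_of_nonneg_right (by positivity) }
  | bid =>
    exact
      { x := (abs_sub _ _).trans (by gcongr; rw [add_right_comm]; exact hcash _ _)
        y := (abs_add_le _ _).trans (by rw [Nat.abs_cast]; omega)
        ask := (z.ask.near_shift _ _).mono (by omega)
        bid := hnew.mono (by omega)
        pa := le_add_of_nonneg_right (by positivity)
        pb := (abs_sub _ _).trans (by gcongr; exact hprice _ _) }

theorem near_jump (ainf binf : ℕ) (z : Book K M) (e : Event K) (u : ℕ) :
    z.Near (K * (ainf + binf) + K + M + 1) (z.jump ainf binf e u) := by
  rcases e with ⟨s, _ | i | i⟩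
  · exact near_react ainf binf z s (card_filter_fin_le _) (Side.near_marketOrder _)
  · exact near_react ainf binf z s (Nat.zero_le _) (Side.near_limitOrder _ i)
  · exact near_react ainf binf z s (Nat.zero_le _) (Side.near_cancelOrder _ i u)

end Book

end Growth

/-! ## A quadratic Lyapunov function -/

section Growth

variable {K M : ℕ}

theorem sq_le_of_abs_le_add {δ u v w : ℝ} (hδ : 0 < δ) (h : |w| ≤ |u| + v) :
    w ^ 2 ≤ (1 + δ) * u ^ 2 + (1 + 1 / δ) * v ^ 2 := by
  have hsq : w ^ 2 ≤ (|u| + v) ^ 2 := by rw [← sq_abs w]; gcongr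
  have hdiff : (1 + δ) * u ^ 2 + (1 + 1 / δ) * v ^ 2 - (|u| + v) ^ 2 = (δ * |u| - v) ^ 2 / δ := by
    rw [← sq_abs u]; field_simp; ring
  have : 0 ≤ (δ * |u| - v) ^ 2 / δ := by positivity
  linarith

/-- The sum of the squares of the positions and ranks of the market maker's orders on one side. -/
noncomputable def Side.ordersSq (s : Side K M) : ℝ :=
  ∑ j, ((s.pos j : ℝ) ^ 2 + (s.rank j : ℝ) ^ 2)

theorem Side.ordersSq_nonneg (s : Side K M) : 0 ≤ s.ordersSq :=
  Finset.sum_nonneg fun _ _ => by positivity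

theorem Side.Near.ordersSq_le {B : ℕ} {s t : Side K M} (h : s.Near B t) {δ S : ℝ} (hδ : 0 < δ)
    (hS : ((∑ i, s.vol i : ℕ) : ℝ) ≤ S) :
    t.ordersSq ≤ (1 + δ) * s.ordersSq + (1 + 1 / δ) * B ^ 2 * (3 * M * (1 + S ^ 2)) := by
  have horder (j : Fin M) : (t.pos j : ℝ) ^ 2 + (t.rank j : ℝ) ^ 2 ≤
      (1 + δ) * ((s.pos j : ℝ) ^ 2 + (s.rank j : ℝ) ^ 2)
        + (1 + 1 / δ) * B ^ 2 * (3 * (1 + S ^ 2)) := by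
    have hpos : |(t.pos j : ℝ)| ≤ |(s.pos j : ℝ)| + B := by exact_mod_cast h.pos j
    have hrank : |(t.rank j : ℝ)| ≤ |(s.rank j : ℝ)| + B * (1 + S) := by
      have : |(t.rank j : ℝ)| ≤ |(s.rank j : ℝ)| + B * (1 + (∑ i, s.vol i : ℕ)) := by
        exact_mod_cast h.rank j
      exact this.trans (by gcongr)
    have hsum : (1 + 1 / δ) * ((B : ℝ) ^ 2 * (1 + (1 + S) ^ 2)) ≤
        (1 + 1 / δ) * ((B : ℝ) ^ 2 * (3 * (1 + S ^ 2))) := by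
      gcongr
      nlinarith [sq_nonneg (1 - S)]
    have := sq_le_of_abs_le_add hδ hpos
    have := sq_le_of_abs_le_add hδ hrank
    linarith
  refine (Finset.sum_le_sum fun j _ => horder j).trans_eq ?_
  rw [Finset.sum_add_distrib, ← Finset.mul_sum, Finset.sum_const, Finset.card_univ,
    Fintype.card_fin, nsmul_eq_mul, Side.ordersSq]
  ring

namespace Book

/-- `|a| + |b|` as a real number. -/
noncomputable def shares (z : Book K M) : ℝ := size z.ask.vol z.bid.vol

/-- The squares of the coordinates of the state that grow by a bounded amount in one step. -/
noncomputable def baseSq (z : Book K M) : ℝ :=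
  z.pa ^ 2 + z.pb ^ 2 + (z.y : ℝ) ^ 2 + z.shares ^ 2

/-- The squares of the coordinates of the state whose growth in one step is controlled by those in
`baseSq`. -/
noncomputable def drivenSq (z : Book K M) : ℝ := z.x ^ 2 + z.ask.ordersSq + z.bid.ordersSq

/-- A quadratic function equivalent to `1 + |z|²`. With the right coefficients, one step of the
dynamics increases it by a factor as close to one as desired. -/
noncomputable def growth (L η : ℝ) (z : Book K M) : ℝ := L + z.baseSq + η * z.drivenSq

theorem shares_nonneg (z : Book K M) : 0 ≤ z.shares := Nat.cast_nonneg _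

theorem baseSq_nonneg (z : Book K M) : 0 ≤ z.baseSq := by unfold baseSq; positivity

theorem drivenSq_nonneg (z : Book K M) : 0 ≤ z.drivenSq := by
  have := z.ask.ordersSq_nonneg
  have := z.bid.ordersSq_nonneg
  unfold drivenSq
  positivity

theorem le_growth (L : ℝ) {η : ℝ} (hη : 0 ≤ η) (z : Book K M) : L ≤ z.growth L η := by
  have := z.baseSq_nonneg
  have := mul_nonneg hη z.drivenSq_nonneg
  unfold growth
  linarith

theorem Near.shares_le {B : ℕ} {z w : Book K M} (h : z.Near B w) :
    w.shares ≤ z.shares + 2 * B := by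
  have := h.ask.vol
  have := h.bid.vol
  unfold shares size
  exact_mod_cast (by omega)

theorem Near.baseSq_le {B : ℕ} {z w : Book K M} (h : z.Near B w) {δ : ℝ} (hδ : 0 < δ) :
    w.baseSq ≤ (1 + δ) * z.baseSq + 7 * (1 + 1 / δ) * B ^ 2 := by
  have hy : |(w.y : ℝ)| ≤ |(z.y : ℝ)| + B := by exact_mod_cast h.y
  have hshares : |w.shares| ≤ |z.shares| + 2 * B := by
    rw [abs_of_nonneg w.shares_nonneg, abs_of_nonneg z.shares_nonneg]
    exact h.shares_le
  have := sq_le_of_abs_le_add hδ h.pa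
  have := sq_le_of_abs_le_add hδ h.pb
  have := sq_le_of_abs_le_add hδ hy
  have := sq_le_of_abs_le_add hδ hshares
  unfold baseSq
  linarith

theorem Near.drivenSq_le {B : ℕ} {z w : Book K M} (h : z.Near B w) {δ : ℝ} (hδ : 0 < δ) :
    w.drivenSq ≤
      (1 + δ) * z.drivenSq + (3 + 6 * M) * (1 + 1 / δ) * B ^ 2 * (1 + z.baseSq) := by
  have hask : ((∑ i, z.ask.vol i : ℕ) : ℝ) ≤ z.shares := by
    unfold shares size
    exact_mod_cast Nat.le_add_right _ _
  have hbid : ((∑ i, z.bid.vol i : ℕ) : ℝ) ≤ z.shares := by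
    unfold shares size
    exact_mod_cast Nat.le_add_left _ _
  have hprices : (1 + |z.pa| + |z.pb|) ^ 2 ≤ 3 * (1 + z.baseSq) := by
    have : 0 ≤ (z.y : ℝ) ^ 2 + z.shares ^ 2 := by positivity
    unfold baseSq
    nlinarith [sq_abs z.pa, sq_abs z.pb, sq_nonneg (|z.pa| - 1), sq_nonneg (|z.pb| - 1),
      sq_nonneg (|z.pa| - |z.pb|)]
  have hS : 1 + z.shares ^ 2 ≤ 1 + z.baseSq := by
    have : 0 ≤ z.pa ^ 2 + z.pb ^ 2 + (z.y : ℝ) ^ 2 := by positivity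
    unfold baseSq
    linarith
  have hrest : (1 + 1 / δ) * (B : ℝ) ^ 2 *
        ((1 + |z.pa| + |z.pb|) ^ 2 + 6 * M * (1 + z.shares ^ 2)) ≤
      (1 + 1 / δ) * (B : ℝ) ^ 2 * (3 * (1 + z.baseSq) + 6 * M * (1 + z.baseSq)) := by
    gcongr
  have := sq_le_of_abs_le_add hδ h.x
  have := h.ask.ordersSq_le hδ hask
  have := h.bid.ordersSq_le hδ hbid
  unfold drivenSq
  linarith

theorem exists_growth_le (K M B : ℕ) {ε : ℝ} (hε : 0 < ε) :
    ∃ L η : ℝ, 1 ≤ L ∧ 0 < η ∧ ∀ z w : Book K M, z.Near B w →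
      w.growth L η ≤ (1 + ε) * z.growth L η := by
  obtain ⟨δ, hδ, rfl⟩ : ∃ δ, 0 < δ ∧ ε = 2 * δ := ⟨ε / 2, by positivity, by ring⟩
  set D : ℝ := (7 + 6 * M) * (1 + 1 / δ) * B ^ 2 with hD
  have hD0 : 0 ≤ D := by positivity
  have hηD : δ / (D + 1) * D ≤ δ := by
    rw [div_mul_eq_mul_div, div_le_iff₀ (by positivity)]
    linarith
  refine ⟨1 + D / δ, δ / (D + 1), by linarith [div_nonneg hD0 hδ.le], by positivity,
    fun z w h => ?_⟩
  set η := δ / (D + 1)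
  have hη : 0 ≤ η := by positivity
  have hbase : w.baseSq ≤ (1 + δ) * z.baseSq + D := by
    have : 0 ≤ 6 * M * (1 + 1 / δ) * (B : ℝ) ^ 2 := by positivity
    have := h.baseSq_le hδ
    linarith
  have hdriven : η * w.drivenSq ≤ (1 + δ) * (η * z.drivenSq) + δ * (1 + z.baseSq) := by
    have hcoef : (3 + 6 * M) * (1 + 1 / δ) * (B : ℝ) ^ 2 ≤ D := by
      rw [hD]
      gcongr
      norm_num
    have hbase0 : 0 ≤ 1 + z.baseSq := by linarith [z.baseSq_nonneg]
    have := mul_le_mul_of_nonneg_left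
      ((h.drivenSq_le hδ).trans (add_le_add_right (mul_le_mul_of_nonneg_right hcoef hbase0) _)) hη
    have := mul_le_mul_of_nonneg_right hηD hbase0
    linarith
  have hL : δ * (1 + D / δ) = δ + D := by field_simp
  have hslack : 0 ≤ δ * (η * z.drivenSq) :=
    mul_nonneg hδ.le (mul_nonneg hη z.drivenSq_nonneg)
  unfold growth
  linarith

theorem normSq_eq (z : Book K M) :
    z.normSq = z.pa ^ 2 + z.pb ^ 2 + (z.y : ℝ) ^ 2
      + ∑ i, ((z.ask.vol i : ℝ) ^ 2 + (z.bid.vol i : ℝ) ^ 2) + z.drivenSq := by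
  simp only [normSq, drivenSq, Side.ordersSq, Finset.sum_add_distrib]
  ring

theorem sum_vol_sq_le (z : Book K M) :
    ∑ i, ((z.ask.vol i : ℝ) ^ 2 + (z.bid.vol i : ℝ) ^ 2) ≤ z.shares ^ 2 := by
  have hside (v : Fin K → ℕ) : ∑ i, (v i : ℝ) ^ 2 ≤ (∑ i, (v i : ℝ)) ^ 2 :=
    Finset.sum_sq_le_sq_sum_of_nonneg fun _ _ => Nat.cast_nonneg _
  have hcross : 0 ≤ (∑ i, (z.ask.vol i : ℝ)) * ∑ i, (z.bid.vol i : ℝ) := by positivity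
  have := hside z.ask.vol
  have := hside z.bid.vol
  rw [Finset.sum_add_distrib, shares, size]
  push_cast
  linarith

theorem shares_sq_le (z : Book K M) :
    z.shares ^ 2 ≤ 2 * K * ∑ i, ((z.ask.vol i : ℝ) ^ 2 + (z.bid.vol i : ℝ) ^ 2) := by
  calc z.shares ^ 2 = (∑ i, ((z.ask.vol i : ℝ) + z.bid.vol i)) ^ 2 := by
        simp [shares, size, Finset.sum_add_distrib]
    _ ≤ K * ∑ i, ((z.ask.vol i : ℝ) + z.bid.vol i) ^ 2 := by
        simpa using sq_sum_le_card_mul_sum_sq (s := (Finset.univ : Finset (Fin K)))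
          (f := fun i => (z.ask.vol i : ℝ) + z.bid.vol i)
    _ ≤ K * ∑ i, 2 * ((z.ask.vol i : ℝ) ^ 2 + (z.bid.vol i : ℝ) ^ 2) := by
        gcongr
        exact add_sq_le
    _ = _ := by rw [← Finset.mul_sum]; ring

theorem exists_growth_le_normSq (K M : ℕ) {L η : ℝ} (hL : 0 ≤ L) (hη : 0 ≤ η) :
    ∃ C : ℝ, 0 < C ∧ ∀ z : Book K M, z.growth L η ≤ C * (1 + z.normSq) := by
  refine ⟨L + η + 2 * K + 1, by positivity, fun z => ?_⟩
  have := z.drivenSq_nonneg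
  have := z.shares_sq_le
  rw [z.normSq_eq, growth, baseSq]
  set P := z.pa ^ 2 + z.pb ^ 2 + (z.y : ℝ) ^ 2
  set v := ∑ i, ((z.ask.vol i : ℝ) ^ 2 + (z.bid.vol i : ℝ) ^ 2)
  have : 0 ≤ P := by positivity
  have : 0 ≤ v := Finset.sum_nonneg fun _ _ => by positivity
  have : 0 ≤ (L + η + 2 * K) * P := by positivity
  have : 0 ≤ (L + 2 * K + 1) * z.drivenSq := by positivity
  have : 0 ≤ (L + η + 1) * v := by positivity
  nlinarith

theorem exists_normSq_le_growth (K M : ℕ) {L η : ℝ} (hL : 1 ≤ L) (hη : 0 < η) :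
    ∃ C : ℝ, 0 < C ∧ ∀ z : Book K M, 1 + z.normSq ≤ C * z.growth L η := by
  refine ⟨1 + 1 / η, by positivity, fun z => ?_⟩
  have hbase := z.baseSq_nonneg
  have hnorm : 1 + z.normSq ≤ 1 + z.baseSq + z.drivenSq := by
    rw [z.normSq_eq, baseSq]
    linarith [z.sum_vol_sq_le]
  have hsplit : (1 + 1 / η) * z.growth L η =
      L + z.baseSq + η * z.drivenSq + 1 / η * (L + z.baseSq) + z.drivenSq := by
    rw [growth]; field_simp; ring
  have : 0 ≤ 1 / η * (L + z.baseSq) := by positivity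
  have := mul_nonneg hη.le z.drivenSq_nonneg
  linarith

theorem measurable_shares : Measurable (shares : Book K M → ℝ) :=
  measurable_of_fibers fun _ _ _ => by simp only [shares]; exact measurable_const

theorem measurable_growth (L η : ℝ) : Measurable (growth L η : Book K M → ℝ) := by
  refine measurable_of_fibers fun y a b => ?_
  simp only [growth, baseSq, drivenSq, shares]
  fun_prop

end Book

end Growth

/-! ## The total intensity -/

section Intensity

variable {K M : ℕ}

theorem card_event (K : ℕ) : Fintype.card (Event K) = 4 * K + 2 := by
  have hside : Fintype.card BookSide = 2 := Fintype.card_congr BookSide.equivBool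
  have horder : Fintype.card (Order K) = 1 + (K + K) := by
    rw [Fintype.card_congr (Order.equivSum K)]; simp
  rw [Fintype.card_prod, hside, horder]; ring

namespace Model

theorem LinearIntensities.exists_le {m : Model K M} (h : m.LinearIntensities) :
    ∃ C : ℝ, 0 ≤ C ∧ ∀ e a b, (m.lam e a b : ℝ) ≤ C * size a b := by
  obtain ⟨cL, cC, cM, h⟩ := h
  refine ⟨max (max |cL| |cC|) |cM|, by positivity, fun e a b => ?_⟩
  obtain ⟨hlimit, hcancel, hmarket⟩ := h a b
  have enlarge : ∀ c : ℝ, |c| ≤ max (max |cL| |cC|) |cM| →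
      c * size a b ≤ max (max |cL| |cC|) |cM| * size a b := fun c hc =>
    mul_le_mul_of_nonneg_right ((le_abs_self c).trans hc) (Nat.cast_nonneg _)
  rcases e with ⟨s, _ | i | i⟩
  · refine le_trans ?_ (hmarket.trans (enlarge _ (le_max_right _ _)))
    cases s <;> simp
  · refine le_trans ?_ ((hlimit s).trans (enlarge _ ((le_max_left _ _).trans (le_max_left _ _))))
    exact Finset.single_le_sum (f := fun i => (m.lam (s, .limit i) a b : ℝ))
      (fun _ _ => NNReal.coe_nonneg _) (Finset.mem_univ i)
  · refine le_trans ?_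
      ((hcancel s).trans (enlarge _ ((le_max_right _ _).trans (le_max_left _ _))))
    exact Finset.single_le_sum (f := fun i => (m.lam (s, .cancel i) a b : ℝ))
      (fun _ _ => NNReal.coe_nonneg _) (Finset.mem_univ i)

variable (m : Model K M)

theorem Lam_nonneg : 0 ≤ m.Lam :=
  mul_nonneg (by positivity) (Real.iSup_nonneg fun _ => by positivity)

theorem rate_le (h : m.LinearIntensities) (z : Book K M) : (m.rate z : ℝ) ≤ m.Lam * z.shares := by
  obtain ⟨C, hC, hle⟩ := h.exists_le
  have hbdd : BddAbove (Set.range fun q : Event K × (Fin K → ℕ) × (Fin K → ℕ) =>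
      (m.lam q.1 q.2.1 q.2.2 : ℝ) / size q.2.1 q.2.2) := by
    refine ⟨C, ?_⟩
    rintro _ ⟨q, rfl⟩
    exact div_le_of_le_mul₀ (Nat.cast_nonneg _) hC (hle _ _ _)
  have hevent : ∀ e, (m.lam e z.ask.vol z.bid.vol : ℝ) ≤
      (⨆ q : Event K × (Fin K → ℕ) × (Fin K → ℕ),
        (m.lam q.1 q.2.1 q.2.2 : ℝ) / size q.2.1 q.2.2) * z.shares := fun e => by
    rcases z.shares_nonneg.eq_or_lt with h0 | hpos
    · have := hle e z.ask.vol z.bid.vol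
      rwa [← h0, mul_zero, ← mul_zero C, h0]
    · rw [← div_le_iff₀ hpos]
      exact le_ciSup hbdd (e, z.ask.vol, z.bid.vol)
  have hsum := Finset.sum_le_card_nsmul Finset.univ _ _ fun e _ => hevent e
  rw [Finset.card_univ, card_event, nsmul_eq_mul] at hsum
  simp only [rate, Lam]
  push_cast at hsum ⊢
  linarith

end Model

end Intensity

/-! ## Weights that decrease along the transition kernel -/

section Weights

theorem lintegral_exp_mul_le_of_supersolution {l t θ : ℝ} {w w' h : ℝ → ℝ} (hl : 0 ≤ l)
    (htθ : t ≤ θ) (hw : ∀ u, HasDerivAt w (w' u) u) (hw' : Continuous w') (hwθ : 0 ≤ w θ)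
    (hh : ∀ u ∈ Set.Ioc t θ, 0 ≤ h u)
    (hle : ∀ u ∈ Set.Ioc t θ, l * h u ≤ l * w u - w' u) :
    ∫⁻ u in Set.Ioc t θ, ENNReal.ofReal (l * Real.exp (-(l * (u - t)))) * ENNReal.ofReal (h u) ≤
      ENNReal.ofReal (w t) := by
  set F' : ℝ → ℝ := fun u => Real.exp (-(l * (u - t))) * (l * w u - w' u) with hF'
  have hderiv (u : ℝ) : HasDerivAt (fun u => -(Real.exp (-(l * (u - t))) * w u)) (F' u) u := by
    have hexp : HasDerivAt (fun u => Real.exp (-(l * (u - t))))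
        (Real.exp (-(l * (u - t))) * -(l * 1)) u :=
      (((hasDerivAt_id u).sub_const t).const_mul l).neg.exp
    exact (hexp.mul (hw u)).neg.congr_deriv (by simp only [hF']; ring)
  have hcont : Continuous F' := by
    have : Continuous w := continuous_iff_continuousAt.2 fun u => (hw u).continuousAt
    fun_prop
  have hdom : ∀ u ∈ Set.Ioc t θ, l * Real.exp (-(l * (u - t))) * h u ≤ F' u := fun u hu => by
    have := mul_le_mul_of_nonneg_left (hle u hu) (Real.exp_nonneg (-(l * (u - t))))
    linarith
  have hnonneg : ∀ u ∈ Set.Ioc t θ, 0 ≤ F' u := fun u hu =>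
    (mul_nonneg (by positivity) (hh u hu)).trans (hdom u hu)
  calc _ ≤ ∫⁻ u in Set.Ioc t θ, ENNReal.ofReal (F' u) := by
        refine setLIntegral_mono' measurableSet_Ioc fun u hu => ?_
        rw [← ENNReal.ofReal_mul (by positivity)]
        exact ENNReal.ofReal_le_ofReal (hdom u hu)
    _ = ENNReal.ofReal (∫ u in t..θ, F' u) := by
        rw [intervalIntegral.integral_of_le htθ, ofReal_integral_eq_lintegral_ofReal]
        · exact hcont.integrableOn_Icc.mono_set Set.Ioc_subset_Icc_self
        · exact (ae_restrict_iff' measurableSet_Ioc).2 (Filter.Eventually.of_forall hnonneg)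
    _ ≤ ENNReal.ofReal (w t) := by
        refine ENNReal.ofReal_le_ofReal ?_
        rw [intervalIntegral.integral_eq_sub_of_hasDerivAt (fun u _ => hderiv u)
          (hcont.intervalIntegrable _ _)]
        have : 0 ≤ Real.exp (-(l * (θ - t))) * w θ := by positivity
        simp only [sub_self, mul_zero, neg_zero, Real.exp_zero]
        linarith

namespace Model

variable {K M : ℕ} (m : Model K M)

theorem lintegral_jumpTime (p : m.TState) {φ : ℝ → ℝ≥0∞} (hφ : Measurable φ) :
    ∫⁻ u, φ u ∂(m.jumpTime p) = ∫⁻ u in Set.Ioc (p.1 : ℝ) m.T,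
      ENNReal.ofReal (m.rate p.2 * Real.exp (-(m.rate p.2 * (u - p.1)))) * φ u := by
  set d : ℝ → ℝ≥0∞ := fun u => if (p.1 : ℝ) < u then
    ENNReal.ofReal (m.rate p.2 * Real.exp (-(m.rate p.2 * (u - p.1)))) else 0 with hd_def
  have hd : Measurable d := Measurable.ite (measurableSet_lt measurable_const measurable_id)
    (by fun_prop) measurable_const
  have hindicator (u : ℝ) : d u * φ u = (Set.Ioi (p.1 : ℝ)).indicator (fun u =>
      ENNReal.ofReal (m.rate p.2 * Real.exp (-(m.rate p.2 * (u - p.1)))) * φ u) u := by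
    by_cases h : (p.1 : ℝ) < u <;> simp [hd_def, h]
  have hinter : Set.Ioi (p.1 : ℝ) ∩ Set.Icc 0 m.T = Set.Ioc (p.1 : ℝ) m.T := by
    ext u
    exact ⟨fun h => ⟨h.1, h.2.2⟩, fun h => ⟨h.1, p.1.2.1.trans h.1.le, h.2⟩⟩
  calc ∫⁻ u, φ u ∂(m.jumpTime p)
      = ∫⁻ u : Set.Icc (0 : ℝ) m.T, d u * φ u
          ∂(Measure.comap ((↑) : Set.Icc (0 : ℝ) m.T → ℝ) volume) := by
        rw [jumpTime]
        exact lintegral_withDensity_eq_lintegral_mul _ (hd.comp measurable_subtype_coe)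
          (hφ.comp measurable_subtype_coe)
    _ = _ := by
        rw [lintegral_subtype_comap measurableSet_Icc fun u => d u * φ u]
        simp only [hindicator]
        rw [setLIntegral_indicator measurableSet_Ioi, hinter]

theorem ae_lt_jumpTime (p : m.TState) : ∀ᵐ u ∂(m.jumpTime p), p.1 < u := by
  rw [jumpTime, ae_withDensity_iff]
  · exact Filter.Eventually.of_forall fun u hu => by
      by_contra h
      exact hu (if_neg h)
  · exact Measurable.ite (measurableSet_lt measurable_const measurable_id) (by fun_prop)
      measurable_const

theorem ae_jumpGoal {z : Book K M} {c : Action M} {P : Book K M → Prop}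
    (hP : MeasurableSet {w | P w}) (h : ∀ e u, P ((z.place c).jump m.ainf m.binf e u)) :
    ∀ᵐ w ∂(m.jumpGoal z c), P w := by
  have hdirac (e : Event K) (u : ℕ) :
      Measure.dirac ((z.place c).jump m.ainf m.binf e u) {w | ¬ P w} = 0 := by
    rw [← Set.compl_ofPred, Measure.dirac_apply' _ hP.compl]
    exact Set.indicator_of_notMem (Set.notMem_compl_iff.2 (h e u)) _
  rw [ae_iff]
  simp only [jumpGoal, Measure.coe_finsetSum, Finset.sum_apply, Measure.smul_apply, smul_eq_mul,
    hdirac, mul_zero, Finset.sum_const_zero]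

theorem lintegral_Q_le (p : m.TState) (c : Action M) {ψ : m.TState → ℝ≥0∞} (hψ : Measurable ψ)
    {φ : ℝ → ℝ≥0∞} (hφ : Measurable φ)
    (h : ∀ (u : Set.Icc (0 : ℝ) m.T) e i, ψ (u, (p.2.place c).jump m.ainf m.binf e i) ≤ φ u) :
    ∫⁻ q, ψ q ∂(m.Q p c) ≤ ∫⁻ u in Set.Ioc (p.1 : ℝ) m.T,
      ENNReal.ofReal (m.rate p.2 * Real.exp (-(m.rate p.2 * (u - p.1)))) * φ u := by
  rw [← m.lintegral_jumpTime p hφ, Q, lintegral_prod _ hψ.aemeasurable]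
  refine lintegral_mono fun u => ?_
  have hae : ∀ᵐ w ∂(m.jumpGoal p.2 c), ψ (u, w) ≤ φ u :=
    m.ae_jumpGoal (measurableSet_le (hψ.comp measurable_prodMk_left) measurable_const) (h u)
  calc ∫⁻ w, ψ (u, w) ∂(m.jumpGoal p.2 c) ≤ ∫⁻ _, φ u ∂(m.jumpGoal p.2 c) :=
        lintegral_mono_ae hae
    _ = φ u * m.jumpGoal p.2 c Set.univ := lintegral_const _
    _ ≤ φ u := mul_le_of_le_one_right' (m.jumpGoal_univ_le p.2 c)

/-- The constant of the one-step growth estimate `near_jump_place`. -/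
def stepBound : ℕ :=
  (K + 2 * M + 1) + (K * (m.ainf + m.binf) + K + M + 1)
    + 2 * (K + 2 * M + 1) * (K * (m.ainf + m.binf) + K + M + 1)

theorem stepBound_pos : 0 < m.stepBound := by unfold stepBound; positivity

theorem near_place {z : Book K M} {c : Action M} (hc : c ∈ z.admissible) :
    z.Near m.stepBound (z.place c) :=
  (Book.near_place hc).mono (by unfold stepBound; omega)

theorem near_jump_place {z : Book K M} {c : Action M} (hc : c ∈ z.admissible) (e : Event K)
    (u : ℕ) : z.Near m.stepBound ((z.place c).jump m.ainf m.binf e u) :=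
  (Book.near_place hc).trans (Book.near_jump _ _ _ e u)

/-- The weight `G(z) e^{ρ(t)(1 + |a| + |b|)}`, where `G` is the quadratic function
`Book.growth L η`. -/
noncomputable def weight (L η : ℝ) (ρ : ℝ → ℝ) (p : m.TState) : ℝ :=
  p.2.growth L η * Real.exp (ρ p.1 * (1 + p.2.shares))

theorem measurable_weight (L η : ℝ) {ρ : ℝ → ℝ} (hρ : Measurable ρ) :
    Measurable (m.weight L η ρ) := by
  have hgrowth : Measurable fun p : m.TState => p.2.growth L η :=
    (Book.measurable_growth L η).comp measurable_snd
  have hshares : Measurable fun p : m.TState => p.2.shares :=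
    Book.measurable_shares.comp measurable_snd
  unfold weight
  fun_prop

theorem growth_le_weight {L η : ℝ} (hL : 0 ≤ L) (hη : 0 ≤ η) {ρ : ℝ → ℝ} {p : m.TState}
    (hρ : 0 ≤ ρ p.1) : p.2.growth L η ≤ m.weight L η ρ p := by
  refine le_mul_of_one_le_right (hL.trans (p.2.le_growth L hη)) (Real.one_le_exp ?_)
  have := p.2.shares_nonneg
  positivity

theorem weight_jump_le {L η ε : ℝ} (hL : 0 ≤ L) (hη : 0 ≤ η) (hε : 0 ≤ ε) {ρ : ℝ → ℝ}
    (hG : ∀ z w : Book K M, z.Near m.stepBound w → w.growth L η ≤ (1 + ε) * z.growth L η)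
    {z : Book K M} {c : Action M} (hc : c ∈ z.admissible) (e : Event K) (i : ℕ)
    {u : Set.Icc (0 : ℝ) m.T} (hu : 0 ≤ ρ u) :
    m.weight L η ρ (u, (z.place c).jump m.ainf m.binf e i) ≤
      (1 + ε) * z.growth L η * Real.exp (ρ u * (1 + z.shares + 2 * m.stepBound)) := by
  have hnear := m.near_jump_place hc e i
  have : 0 ≤ z.growth L η := hL.trans (z.le_growth L hη)
  refine mul_le_mul (hG _ _ hnear) (Real.exp_le_exp.2 (mul_le_mul_of_nonneg_left ?_ hu))
    (Real.exp_nonneg _) (by positivity)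
  linarith [hnear.shares_le]

theorem lintegral_weight_le {L η ε κ θ : ℝ} (hL : 0 ≤ L) (hη : 0 ≤ η) (hε : 0 ≤ ε) (hκ : 0 ≤ κ)
    {ρ ρ' : ℝ → ℝ} (hρ : ∀ u, HasDerivAt ρ (ρ' u) u) (hρ' : Continuous ρ')
    (hG : ∀ z w : Book K M, z.Near m.stepBound w → w.growth L η ≤ (1 + ε) * z.growth L η)
    {p : m.TState} {c : Action M} (hc : c ∈ p.2.admissible) (hpθ : p.1 ≤ θ) (hθT : θ ≤ m.T)
    (hpos : ∀ u ≤ θ, 0 ≤ ρ u)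
    (hrate : ∀ u ∈ Set.Ioc (p.1 : ℝ) θ,
      (1 + ε) * m.rate p.2 * Real.exp (ρ u * (2 * m.stepBound)) ≤
        κ * (m.rate p.2 - ρ' u * (1 + p.2.shares))) :
    ∫⁻ q, (if (q.1 : ℝ) ≤ θ then ENNReal.ofReal (m.weight L η ρ q) else 0) ∂(m.Q p c) ≤
      ENNReal.ofReal (κ * m.weight L η ρ p) := by
  set S : ℝ := p.2.shares
  set G : ℝ := p.2.growth L η
  have hG0 : 0 ≤ G := hL.trans (p.2.le_growth L hη)
  have hρc : Continuous ρ := continuous_iff_continuousAt.2 fun u => (hρ u).continuousAt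
  set h : ℝ → ℝ := fun u => (1 + ε) * G * Real.exp (ρ u * (1 + S + 2 * m.stepBound)) with hh
  set φ : ℝ → ℝ≥0∞ := (Set.Iic θ).indicator fun u => ENNReal.ofReal (h u) with hφ
  set d : ℝ → ℝ≥0∞ := fun u =>
    ENNReal.ofReal (m.rate p.2 * Real.exp (-(m.rate p.2 * (u - p.1))))
  have hsplit : (fun u => d u * φ u) = (Set.Iic θ).indicator fun u => d u * ENNReal.ofReal (h u) :=
    funext fun _ => (Set.indicator_mul_right (Set.Iic θ) d fun u => ENNReal.ofReal (h u)).symm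
  have hinter : Set.Iic θ ∩ Set.Ioc (p.1 : ℝ) m.T = Set.Ioc (p.1 : ℝ) θ := by
    rw [Set.inter_comm, Set.Ioc_inter_Iic, min_eq_right hθT]
  refine (m.lintegral_Q_le p c (φ := φ) ?_ ?_ fun u e i => ?_).trans ?_
  · exact Measurable.ite (measurableSet_le (by fun_prop) measurable_const)
      (m.measurable_weight L η hρc.measurable).ennreal_ofReal measurable_const
  · exact Measurable.indicator (by fun_prop) measurableSet_Iic
  · by_cases hu : (u : ℝ) ≤ θ
    · rw [if_pos hu, hφ, Set.indicator_of_mem (Set.mem_Iic.2 hu)]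
      exact ENNReal.ofReal_le_ofReal (m.weight_jump_le hL hη hε hG hc e i (hpos u hu))
    · rw [if_neg hu]
      exact zero_le
  rw [hsplit, setLIntegral_indicator measurableSet_Iic, hinter]
  refine lintegral_exp_mul_le_of_supersolution (w := fun u => κ * (G * Real.exp (ρ u * (1 + S))))
    (NNReal.coe_nonneg _) hpθ
    (fun u => ((((hρ u).mul_const (1 + S)).exp.const_mul G).const_mul κ))
    (by fun_prop) (by positivity) (fun u _ => by positivity) fun u hu => ?_
  have := mul_le_mul_of_nonneg_left (hrate u hu)
    (mul_nonneg hG0 (Real.exp_nonneg (ρ u * (1 + S))))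
  simp only [hh, mul_add (ρ u) (1 + S), Real.exp_add]
  linarith

end Model

end Weights

section Lyapunov

theorem mul_exp_le_of_le {l Λ S ε x : ℝ} (hl₀ : 0 ≤ l) (hl : l ≤ Λ * S) (hΛ : 0 ≤ Λ)
    (hε₀ : 0 < ε) (hε₁ : ε ≤ 1) (hx₀ : 0 ≤ x) (hx₁ : x ≤ 1 / 2) :
    (1 + ε) * l * Real.exp x ≤ 1 / (1 + ε) * (l + Λ * (3 * ε + 8 * x) * (1 + S)) := by
  have hexp : Real.exp x ≤ 1 + 2 * x :=
    (Real.exp_bound_div_one_sub_of_interval hx₀ (by linarith)).trans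
      ((div_le_iff₀ (by linarith)).2 (by nlinarith))
  have hfactor : (1 + ε) * (1 + ε) * Real.exp x ≤ 1 + (3 * ε + 8 * x) :=
    calc (1 + ε) * (1 + ε) * Real.exp x ≤ (1 + 3 * ε) * (1 + 2 * x) := by gcongr; nlinarith
      _ ≤ 1 + (3 * ε + 8 * x) := by nlinarith
  have hrate : l * (3 * ε + 8 * x) ≤ Λ * (1 + S) * (3 * ε + 8 * x) := by
    gcongr
    nlinarith
  rw [one_div, inv_mul_eq_div, le_div_iff₀ (by positivity)]
  linarith [mul_le_mul_of_nonneg_left hfactor hl₀]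

theorem exists_pos_mul_exp_le {γ : ℝ} (hγ : 0 < γ) (x : ℝ) :
    ∃ ε, 0 < ε ∧ ε ≤ 1 ∧ ε * Real.exp x ≤ 1 ∧ 3 * ε * Real.exp x ≤ γ := by
  have hpos := Real.exp_pos x
  refine ⟨min 1 (min (1 / Real.exp x) (γ / (3 * Real.exp x))), by positivity, min_le_left _ _,
    ?_, ?_⟩
  · rw [← le_div_iff₀ hpos]
    exact (min_le_right _ _).trans (min_le_left _ _)
  · rw [mul_comm 3, mul_assoc, ← le_div_iff₀ (by positivity)]
    exact (min_le_right _ _).trans (min_le_right _ _)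

namespace Model

variable {K M : ℕ} (m : Model K M)

/-- The rate at which `lyapunovExponent` decays. -/
noncomputable def decayRate : ℝ := 16 * m.stepBound * m.Lam

theorem decayRate_nonneg : 0 ≤ m.decayRate := by
  have := m.Lam_nonneg
  unfold decayRate
  positivity

/-- The solution of `ρ' = -Λ (3 ε + 8 (2 B) ρ)`, `ρ(T) = 0`, where `B` is `stepBound`: the exponent
of a weight that contracts by the factor `1 / (1 + ε)` along the transition kernel. -/
noncomputable def lyapunovExponent (ε u : ℝ) : ℝ :=
  3 * ε / (16 * m.stepBound) * (Real.exp (m.decayRate * (m.T - u)) - 1)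

theorem hasDerivAt_lyapunovExponent (ε u : ℝ) :
    HasDerivAt (m.lyapunovExponent ε)
      (-(m.Lam * (3 * ε + 8 * (m.lyapunovExponent ε u * (2 * m.stepBound))))) u := by
  have hlin : HasDerivAt (fun u => m.decayRate * (m.T - u)) (m.decayRate * -1) u :=
    ((hasDerivAt_id u).const_sub m.T).const_mul m.decayRate
  have : (m.stepBound : ℝ) ≠ 0 := Nat.cast_ne_zero.2 m.stepBound_pos.ne'
  refine ((hlin.exp.sub_const 1).const_mul (3 * ε / (16 * m.stepBound))).congr_deriv ?_
  simp only [lyapunovExponent, decayRate]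
  field_simp
  ring

theorem continuous_lyapunovExponent (ε : ℝ) : Continuous (m.lyapunovExponent ε) := by
  unfold lyapunovExponent
  fun_prop

theorem lyapunovExponent_nonneg {ε u : ℝ} (hε : 0 ≤ ε) (hu : u ≤ m.T) :
    0 ≤ m.lyapunovExponent ε u := by
  refine mul_nonneg (by positivity) (sub_nonneg.2 (Real.one_le_exp ?_))
  exact mul_nonneg m.decayRate_nonneg (sub_nonneg.2 hu)

theorem exp_decayRate_le {u : ℝ} (hu : 0 ≤ u) :
    Real.exp (m.decayRate * (m.T - u)) ≤ Real.exp (m.decayRate * m.T) :=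
  Real.exp_le_exp.2 (mul_le_mul_of_nonneg_left (by linarith) m.decayRate_nonneg)

theorem lyapunovExponent_mul_le {ε u : ℝ} (hε : 0 ≤ ε) (hu : 0 ≤ u) :
    m.lyapunovExponent ε u * (2 * m.stepBound) ≤ ε * Real.exp (m.decayRate * m.T) / 2 := by
  have : (m.stepBound : ℝ) ≠ 0 := Nat.cast_ne_zero.2 m.stepBound_pos.ne'
  calc m.lyapunovExponent ε u * (2 * m.stepBound)
      = 3 / 8 * ε * (Real.exp (m.decayRate * (m.T - u)) - 1) := by
        rw [lyapunovExponent]; field_simp; ring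
    _ ≤ 3 / 8 * ε * Real.exp (m.decayRate * m.T) := by
        gcongr
        linarith [m.exp_decayRate_le hu]
    _ ≤ ε * Real.exp (m.decayRate * m.T) / 2 := by
        linarith [mul_nonneg hε (Real.exp_nonneg (m.decayRate * m.T))]

theorem lyapunovExponent_le {ε u : ℝ} (hε : 0 ≤ ε) (hu₀ : 0 ≤ u) (huT : u ≤ m.T) :
    m.lyapunovExponent ε u ≤ 3 * ε * Real.exp (m.decayRate * m.T) * m.Lam * (m.T - u) := by
  set x : ℝ := m.decayRate * (m.T - u)
  have hx : 0 ≤ x := mul_nonneg m.decayRate_nonneg (sub_nonneg.2 huT)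
  have hconvex : Real.exp x - 1 ≤ x * Real.exp x := by
    have hinv : Real.exp (-x) * Real.exp x = 1 := by rw [← Real.exp_add]; simp
    nlinarith [Real.add_one_le_exp (-x), Real.exp_pos x]
  have : (m.stepBound : ℝ) ≠ 0 := Nat.cast_ne_zero.2 m.stepBound_pos.ne'
  calc m.lyapunovExponent ε u
      ≤ 3 * ε / (16 * m.stepBound) * (x * Real.exp (m.decayRate * m.T)) := by
        unfold lyapunovExponent
        gcongr
        exact hconvex.trans (mul_le_mul_of_nonneg_left (m.exp_decayRate_le hu₀) hx)
    _ = _ := by simp only [x, decayRate]; field_simp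

theorem lintegral_weight_lyapunovExponent_le (hlam : m.LinearIntensities) {L η ε : ℝ}
    (hL : 0 ≤ L) (hη : 0 ≤ η) (hε₀ : 0 < ε) (hε₁ : ε ≤ 1)
    (hεT : ε * Real.exp (m.decayRate * m.T) ≤ 1)
    (hG : ∀ z w : Book K M, z.Near m.stepBound w → w.growth L η ≤ (1 + ε) * z.growth L η)
    {p : m.TState} {c : Action M} (hc : c ∈ p.2.admissible) :
    ∫⁻ q, ENNReal.ofReal (m.weight L η (m.lyapunovExponent ε) q) ∂(m.Q p c) ≤
      ENNReal.ofReal (1 / (1 + ε) * m.weight L η (m.lyapunovExponent ε) p) := by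
  have hρ := m.continuous_lyapunovExponent ε
  have hle := m.lintegral_weight_le hL hη hε₀.le (κ := 1 / (1 + ε)) (by positivity)
    (m.hasDerivAt_lyapunovExponent ε) (by fun_prop) hG hc p.1.2.2 le_rfl
    (fun u hu => m.lyapunovExponent_nonneg hε₀.le hu) fun u hu => ?_
  · exact (lintegral_congr fun q => (if_pos q.1.2.2).symm).trans_le hle
  · have hsmall := m.lyapunovExponent_mul_le hε₀.le (p.1.2.1.trans hu.1.le)
    refine (mul_exp_le_of_le (NNReal.coe_nonneg _) (m.rate_le hlam p.2) m.Lam_nonneg hε₀ hε₁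
      (mul_nonneg (m.lyapunovExponent_nonneg hε₀.le hu.2) (by positivity))
      (by linarith)).trans_eq ?_
    ring

theorem one_add_normSq_place_le {L η ε C : ℝ} (hL : 0 ≤ L) (hη : 0 ≤ η) (hε : 0 ≤ ε)
    (hC : 0 ≤ C) (hnorm : ∀ z : Book K M, 1 + z.normSq ≤ C * z.growth L η)
    (hG : ∀ z w : Book K M, z.Near m.stepBound w → w.growth L η ≤ (1 + ε) * z.growth L η)
    {ρ : ℝ → ℝ} {p : m.TState} (hρ : 0 ≤ ρ p.1) {c : Action M} (hc : c ∈ p.2.admissible) :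
    1 + (p.2.place c).normSq ≤ C * (1 + ε) * m.weight L η ρ p :=
  calc 1 + (p.2.place c).normSq ≤ C * ((1 + ε) * p.2.growth L η) :=
        (hnorm _).trans (mul_le_mul_of_nonneg_left (hG _ _ (m.near_place hc)) hC)
    _ ≤ C * ((1 + ε) * m.weight L η ρ p) := by
        gcongr
        exact m.growth_le_weight hL hη hρ
    _ = C * (1 + ε) * m.weight L η ρ p := by ring

theorem weight_le_bound {L η γ₀ C : ℝ} (hL : 0 ≤ L) (hη : 0 ≤ η) {ρ : ℝ → ℝ} {p : m.TState}
    (hC : p.2.growth L η ≤ C * (1 + p.2.normSq))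
    (hρ : ρ p.1 ≤ γ₀ * (4 * K + 2) * m.Lam * (m.T - p.1)) :
    m.weight L η ρ p ≤ C * m.bound γ₀ p := by
  have hgrowth : 0 ≤ p.2.growth L η := hL.trans (p.2.le_growth L hη)
  have := p.2.shares_nonneg
  rw [weight, bound, ← mul_assoc]
  refine mul_le_mul hC (Real.exp_le_exp.2 ?_) (Real.exp_nonneg _) (hgrowth.trans hC)
  calc ρ p.1 * (1 + p.2.shares)
      ≤ γ₀ * (4 * K + 2) * m.Lam * (m.T - p.1) * (1 + p.2.shares) := by gcongr
    _ = _ := by rw [Book.shares]; ring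

/-- A weight that contracts along the transition kernel with factor `κ`, and that dominates the
rewards up to the constant `C`. -/
structure IsLyapunov (W : m.TState → ℝ) (κ C : ℝ) : Prop where
  measurable : Measurable W
  one_le : ∀ p, 1 ≤ W p
  nonneg : 0 ≤ κ
  lt_one : κ < 1
  lintegral_le : ∀ p, ∀ c ∈ p.2.admissible,
    ∫⁻ q, ENNReal.ofReal (W q) ∂(m.Q p c) ≤ ENNReal.ofReal (κ * W p)
  const_nonneg : 0 ≤ C
  running_le : ∀ p, ∀ c ∈ p.2.admissible, |m.f (p.2.place c) c| ≤ C * W p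
  terminal_le : ∀ p, ∀ c ∈ p.2.admissible, |m.g (p.2.place c)| ≤ C * W p

theorem exists_isLyapunov (hlam : m.LinearIntensities) (hrew : m.QuadraticRewards)
    {γ₀ : ℝ} (hγ₀ : 0 < γ₀) :
    ∃ W κ C, m.IsLyapunov W κ C ∧ ∃ D, 0 ≤ D ∧ ∀ p, W p ≤ D * m.bound γ₀ p := by
  obtain ⟨ε, hε₀, hε₁, hεT, hεγ⟩ :=
    exists_pos_mul_exp_le (γ := γ₀ * (4 * K + 2)) (by positivity) (m.decayRate * m.T)
  obtain ⟨L, η, hL, hη, hG⟩ := Book.exists_growth_le K M m.stepBound hε₀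
  have hL₀ : 0 ≤ L := zero_le_one.trans hL
  obtain ⟨C₁, hC₁, hgrowth⟩ := Book.exists_growth_le_normSq K M hL₀ hη.le
  obtain ⟨C₂, hC₂, hnorm⟩ := Book.exists_normSq_le_growth K M hL hη
  obtain ⟨⟨c₅, hc₅, hf⟩, c₆, hc₆, hg⟩ := hrew
  set W := m.weight L η (m.lyapunovExponent ε)
  have hρ (p : m.TState) : 0 ≤ m.lyapunovExponent ε p.1 :=
    m.lyapunovExponent_nonneg hε₀.le p.1.2.2
  have hone (p : m.TState) : 1 ≤ W p :=
    hL.trans ((p.2.le_growth L hη.le).trans (m.growth_le_weight hL₀ hη.le (hρ p)))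
  have hreward {p : m.TState} {c : Action M} (hc : c ∈ p.2.admissible) {k : ℝ} (hk : 0 ≤ k)
      (hk' : k ≤ c₅ + c₆) :
      k * (1 + (p.2.place c).normSq) ≤ (c₅ + c₆) * (C₂ * (1 + ε)) * W p := by
    have := zero_le_one.trans (hone p)
    have := m.one_add_normSq_place_le hL₀ hη.le hε₀.le hC₂.le hnorm hG (hρ p) hc
    calc k * (1 + (p.2.place c).normSq) ≤ k * (C₂ * (1 + ε) * W p) := by gcongr
      _ ≤ (c₅ + c₆) * (C₂ * (1 + ε) * W p) := by gcongr
      _ = _ := by ring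
  refine ⟨W, 1 / (1 + ε), (c₅ + c₆) * (C₂ * (1 + ε)), ?_, C₁, hC₁.le, fun p =>
    m.weight_le_bound hL₀ hη.le (hgrowth p.2) ?_⟩
  · exact
      { measurable := m.measurable_weight L η (m.continuous_lyapunovExponent ε).measurable
        one_le := hone
        nonneg := by positivity
        lt_one := by rw [div_lt_one (by positivity)]; linarith
        lintegral_le := fun _ _ =>
          m.lintegral_weight_lyapunovExponent_le hlam hL₀ hη.le hε₀ hε₁ hεT hG
        const_nonneg := by positivity
        running_le := fun p c hc => (hf (p.2.place c) c hc).trans (hreward hc hc₅.le (by linarith))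
        terminal_le := fun p c hc => (hg _).trans (hreward hc hc₆.le (by linarith)) }
  · have := m.Lam_nonneg
    refine (m.lyapunovExponent_le hε₀.le p.1.2.1 p.1.2.2).trans ?_
    have : 0 ≤ m.T - p.1 := sub_nonneg.2 p.1.2.2
    gcongr

end Model

end Lyapunov

/-! ## The maximal reward operator -/

section Measure

variable {α : Type*} [MeasurableSpace α]

theorem lintegral_enorm_le_of_abs_le_mul {μ : Measure α} {u h : α → ℝ} {C H : ℝ} (hC : 0 ≤ C)
    (hle : ∀ᵐ x ∂μ, |u x| ≤ C * h x) (hh : ∫⁻ x, ENNReal.ofReal (h x) ∂μ ≤ ENNReal.ofReal H) :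
    ∫⁻ x, ‖u x‖ₑ ∂μ ≤ ENNReal.ofReal (C * H) := by
  calc ∫⁻ x, ‖u x‖ₑ ∂μ ≤ ∫⁻ x, ENNReal.ofReal C * ENNReal.ofReal (h x) ∂μ := by
        refine lintegral_mono_ae (hle.mono fun x hx => ?_)
        rw [← ENNReal.ofReal_mul hC, Real.enorm_eq_ofReal_abs]
        exact ENNReal.ofReal_le_ofReal hx
    _ = ENNReal.ofReal C * ∫⁻ x, ENNReal.ofReal (h x) ∂μ :=
        lintegral_const_mul' _ _ ENNReal.ofReal_ne_top
    _ ≤ ENNReal.ofReal (C * H) := by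
        rw [ENNReal.ofReal_mul hC]
        gcongr

theorem abs_integral_le_of_lintegral_enorm_le {μ : Measure α} {u : α → ℝ} {H : ℝ} (hH : 0 ≤ H)
    (h : ∫⁻ x, ‖u x‖ₑ ∂μ ≤ ENNReal.ofReal H) : |∫ x, u x ∂μ| ≤ H := by
  rw [← ENNReal.ofReal_le_ofReal_iff hH, ← Real.enorm_eq_ofReal_abs]
  exact (enorm_integral_le_lintegral_enorm u).trans h

theorem exists_measurable_argmax {β γ : Type*} [MeasurableSpace β] [Countable β] [Nonempty β]
    [LinearOrder γ] [TopologicalSpace γ] [OrderClosedTopology γ] [SecondCountableTopology γ]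
    [MeasurableSpace γ] [OpensMeasurableSpace γ] {s : α → Set β}
    (hs : ∀ b, MeasurableSet {a | b ∈ s a}) (hfin : ∀ a, (s a).Finite)
    (hne : ∀ a, (s a).Nonempty) {f : α → β → γ} (hf : ∀ b, Measurable fun a => f a b) :
    ∃ φ : α → β, Measurable φ ∧ ∀ a, φ a ∈ s a ∧ ∀ b ∈ s a, f a b ≤ f a (φ a) := by
  classical
  obtain ⟨e, he⟩ := exists_surjective_nat β
  let P : ℕ → α → Prop := fun n a => e n ∈ s a ∧ ∀ b, b ∈ s a → f a b ≤ f a (e n)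
  have hP (n : ℕ) : MeasurableSet {a | P n a} := by
    have hle (b : β) : MeasurableSet {a | b ∈ s a → f a b ≤ f a (e n)} := by
      simp only [imp_iff_not_or]
      exact (hs b).compl.union (measurableSet_le (hf b) (hf (e n)))
    have hforall : MeasurableSet {a | ∀ b, b ∈ s a → f a b ≤ f a (e n)} := by
      simpa only [Set.ofPred_forall] using MeasurableSet.iInter hle
    exact (hs _).inter hforall
  have hex (a : α) : ∃ n, P n a := by
    obtain ⟨b, hb, hmax⟩ := (hfin a).exists_maximalFor (f a) _ (hne a)
    obtain ⟨n, rfl⟩ := he b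
    exact ⟨n, hb, fun b' hb' => (le_total _ _).elim id fun h => hmax hb' h⟩
  exact ⟨fun a => e (Nat.find (hex a)),
    Measurable.find (f := fun n _ => e n) (fun _ => measurable_const) hP hex,
    fun a => Nat.find_spec (hex a)⟩

/-- The measurable functions that are bounded by a multiple of the weight `W`. -/
def WeightBounded (W v : α → ℝ) : Prop :=
  Measurable v ∧ ∃ D, 0 ≤ D ∧ ∀ p, |v p| ≤ D * W p

theorem WeightBounded.zero (W : α → ℝ) : WeightBounded W 0 :=
  ⟨measurable_zero, 0, le_rfl, fun _ => by simp⟩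

theorem WeightBounded.mono {W W' v : α → ℝ} (hv : WeightBounded W v) {D : ℝ} (hD : 0 ≤ D)
    (hle : ∀ p, W p ≤ D * W' p) : WeightBounded W' v := by
  obtain ⟨hmeas, D', hD', hbound⟩ := hv
  refine ⟨hmeas, D' * D, mul_nonneg hD' hD, fun p => (hbound p).trans ?_⟩
  rw [mul_assoc]
  exact mul_le_mul_of_nonneg_left (hle p) hD'

variable {W : α → ℝ} {κ : ℝ} {Φ : (α → ℝ) → α → ℝ}

theorem WeightBounded.iterate (hκ : 0 ≤ κ)
    (hmeas : ∀ v, WeightBounded W v → Measurable (Φ v)) (hzero : WeightBounded W (Φ 0))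
    (hcontr : ∀ v w, WeightBounded W v → WeightBounded W w → ∀ D, 0 ≤ D →
      (∀ p, |v p - w p| ≤ D * W p) → ∀ p, |Φ v p - Φ w p| ≤ κ * D * W p) (n : ℕ) :
    WeightBounded W (Φ^[n] 0) := by
  obtain ⟨-, R, hR, hΦ⟩ := hzero
  induction n with
  | zero => exact WeightBounded.zero W
  | succ n ih =>
    obtain ⟨-, D, hD, hle⟩ := id ih
    rw [Function.iterate_succ_apply']
    refine ⟨hmeas _ ih, κ * D + R, by positivity, fun p => ?_⟩
    have := hcontr _ 0 ih (WeightBounded.zero W) D hD (by simpa using hle) p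
    have := hΦ p
    have := abs_add_le (Φ (Φ^[n] 0) p - Φ 0 p) (Φ 0 p)
    rw [sub_add_cancel] at this
    linarith

theorem exists_weightBounded_fixedPoint (hκ₀ : 0 ≤ κ) (hκ₁ : κ < 1)
    (hmeas : ∀ v, WeightBounded W v → Measurable (Φ v)) (hzero : WeightBounded W (Φ 0))
    (hcontr : ∀ v w, WeightBounded W v → WeightBounded W w → ∀ D, 0 ≤ D →
      (∀ p, |v p - w p| ≤ D * W p) → ∀ p, |Φ v p - Φ w p| ≤ κ * D * W p) :
    ∃ v, WeightBounded W v ∧ Φ v = v := by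
  have hu := WeightBounded.iterate hκ₀ hmeas hzero hcontr
  obtain ⟨-, R, hR, hΦ⟩ := hzero
  have hstep (n : ℕ) : ∀ p, |Φ^[n] 0 p - Φ^[n + 1] 0 p| ≤ R * κ ^ n * W p := by
    induction n with
    | zero => simpa using hΦ
    | succ n ih =>
      intro p
      rw [Function.iterate_succ_apply', Function.iterate_succ_apply' _ (n + 1)]
      exact (hcontr _ _ (hu n) (hu (n + 1)) _ (by positivity) ih p).trans_eq (by ring)
  have hgeom (p : α) (n : ℕ) : dist (Φ^[n] 0 p) (Φ^[n + 1] 0 p) ≤ R * W p * κ ^ n := by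
    rw [Real.dist_eq]
    exact (hstep n p).trans_eq (by ring)
  choose v hv using fun p =>
    cauchySeq_tendsto_of_complete (cauchySeq_of_le_geometric κ _ hκ₁ (hgeom p))
  have : 0 ≤ 1 - κ := sub_nonneg.2 hκ₁.le
  have hdist (n : ℕ) (p : α) : |Φ^[n] 0 p - v p| ≤ R * κ ^ n / (1 - κ) * W p := by
    rw [← Real.dist_eq]
    exact (dist_le_of_le_geometric_of_tendsto κ _ hκ₁ (hgeom p) (hv p) n).trans_eq (by ring)
  have hvW : WeightBounded W v :=
    ⟨measurable_of_tendsto_metrizable (fun n => (hu n).1) (tendsto_pi_nhds.2 hv),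
      R / (1 - κ), by positivity, fun p => by simpa using hdist 0 p⟩
  refine ⟨v, hvW, funext fun p => tendsto_nhds_unique ?_
    ((hv p).comp (Filter.tendsto_add_atTop_nat 1))⟩
  rw [tendsto_iff_dist_tendsto_zero]
  refine squeeze_zero (g := fun n => κ * (R * κ ^ n / (1 - κ)) * W p) (fun _ => dist_nonneg)
    (fun n => ?_) ?_
  · rw [Real.dist_eq, Function.comp_apply, Function.iterate_succ_apply']
    exact hcontr _ _ (hu n) hvW _ (by positivity) (hdist n) p
  · simpa using ((((tendsto_pow_atTop_nhds_zero_of_lt_one hκ₀ hκ₁).const_mul R).div_const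
      (1 - κ)).const_mul κ).mul_const (W p)

end Measure

section Bellman

variable {K M : ℕ}

theorem Book.admissible_finite (z : Book K M) : z.admissible.Finite := by
  have hbox : (Set.univ.pi fun _ : Fin M => Set.Icc (-((K : ℤ) + 1)) (K + 1)).Finite :=
    Set.Finite.pi fun _ => Set.finite_Icc _ _
  refine (hbox.prod hbox).subset fun c hc => ?_
  obtain ⟨hask, hbid⟩ := Book.abs_le_of_mem_admissible hc
  exact ⟨fun j _ => abs_le.1 (hask j), fun j _ => abs_le.1 (hbid j)⟩

theorem Book.admissible_nonempty (z : Book K M) : z.admissible.Nonempty :=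
  ⟨(fun _ => -1, fun _ => -1), fun _ => Or.inl rfl, fun _ => Or.inl rfl⟩

theorem Book.measurableSet_admissible (c : Action M) :
    MeasurableSet {z : Book K M | c ∈ z.admissible} :=
  measurableSet_setOfPred.2 (measurable_of_fibers fun y a b =>
    (measurable_const :
      Measurable fun _ : ℝ × ℝ × ℝ => c ∈ (⟨0, y, a, b, 0, 0⟩ : Book K M).admissible))

namespace Model

theorem meanSojourn_nonneg {l τ : ℝ} (hl : 0 ≤ l) (hτ : 0 ≤ τ) : 0 ≤ meanSojourn l τ := by
  unfold meanSojourn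
  split_ifs
  · exact hτ
  · rw [← sub_div]
    refine div_nonneg (sub_nonneg.2 (Real.exp_le_one_iff.2 ?_)) hl
    rw [neg_nonpos]
    positivity

theorem meanSojourn_le {l τ : ℝ} (hl : 0 ≤ l) : meanSojourn l τ ≤ τ := by
  unfold meanSojourn
  split_ifs with h
  · exact le_rfl
  · rw [← sub_div, div_le_iff₀ (hl.lt_of_ne' h)]
    linarith [Real.add_one_le_exp (-(l * τ))]

variable (m : Model K M)

theorem measurable_r (hf : ∀ a, Measurable fun z => m.f z a) (hg : Measurable m.g)
    (c : Action M) : Measurable fun p : m.TState => m.r p c := by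
  have hrate : Measurable fun p : m.TState => (m.rate p.2 : ℝ) :=
    (m.measurable_rate.comp measurable_snd).coe_nnreal_real
  have hplace : Measurable fun p : m.TState => p.2.place c :=
    (measurable_place c).comp measurable_snd
  have hsojourn : Measurable fun p : m.TState => meanSojourn (m.rate p.2) (m.T - p.1) := by
    unfold meanSojourn
    refine Measurable.ite (measurableSet_eq_fun hrate measurable_const) ?_ ?_ <;> fun_prop
  have hrunning : Measurable fun p : m.TState => m.f (p.2.place c) c := (hf c).comp hplace
  have hterminal : Measurable fun p : m.TState => m.g (p.2.place c) := hg.comp hplace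
  unfold r
  fun_prop

theorem Q_univ_le (p : m.TState) (c : Action M) : m.Q p c Set.univ ≤ 1 := by
  rw [Q, ← Set.univ_prod_univ, Measure.prod_prod]
  exact mul_le_one' (m.jumpTime_univ_le _) (m.jumpGoal_univ_le _ _)

/-- The transition kernel of the Markov decision process for a fixed action. -/
noncomputable def kernelQ (c : Action M) : Kernel m.TState m.TState where
  toFun p := m.Q p c
  measurable' := m.measurable_Q.comp (f := fun p : m.TState => (p, c))
    (measurable_id.prodMk measurable_const)

instance (c : Action M) : IsFiniteKernel (m.kernelQ c) :=
  ⟨1, ENNReal.one_lt_top, fun p => m.Q_univ_le p c⟩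

theorem measurable_actionValue (hf : ∀ a, Measurable fun z => m.f z a) (hg : Measurable m.g)
    {v : m.TState → ℝ} (hv : Measurable v) (c : Action M) :
    Measurable fun p : m.TState => m.actionValue v p c :=
  (m.measurable_r hf hg c).add
    (hv.stronglyMeasurable.integral_kernel (κ := m.kernelQ c)).measurable

theorem actionValue_le_bellman (v : m.TState → ℝ) (p : m.TState) {c : Action M}
    (hc : c ∈ p.2.admissible) : m.actionValue v p c ≤ m.bellman v p := by
  have : Finite p.2.admissible := p.2.admissible_finite
  exact le_ciSup (f := fun c : p.2.admissible => m.actionValue v p c)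
    (Set.finite_range _).bddAbove ⟨c, hc⟩

theorem bellman_le (v : m.TState → ℝ) (p : m.TState) {b : ℝ}
    (h : ∀ c ∈ p.2.admissible, m.actionValue v p c ≤ b) : m.bellman v p ≤ b := by
  have : Nonempty p.2.admissible := p.2.admissible_nonempty.to_subtype
  exact ciSup_le fun c => h c c.2

theorem exists_isMaximizer (hf : ∀ a, Measurable fun z => m.f z a) (hg : Measurable m.g)
    {v : m.TState → ℝ} (hv : Measurable v) : ∃ F : m.DecisionRule, m.IsMaximizer v F := by
  obtain ⟨φ, hφ, hmax⟩ := exists_measurable_argmax (s := fun p : m.TState => p.2.admissible)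
    (fun c => measurable_snd (Book.measurableSet_admissible c)) (fun p => p.2.admissible_finite)
    (fun p => p.2.admissible_nonempty) (m.measurable_actionValue hf hg hv)
  exact ⟨⟨φ, hφ, fun p => (hmax p).1⟩, fun p =>
    (m.actionValue_le_bellman v p (hmax p).1).antisymm (m.bellman_le v p (hmax p).2)⟩

theorem measurable_bellman (hf : ∀ a, Measurable fun z => m.f z a) (hg : Measurable m.g)
    {v : m.TState → ℝ} (hv : Measurable v) : Measurable (m.bellman v) := by
  obtain ⟨F, hF⟩ := m.exists_isMaximizer hf hg hv
  have hvalue : Measurable fun q : m.TState × Action M => m.actionValue v q.1 q.2 :=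
    measurable_from_prod_countable_left fun c => m.measurable_actionValue hf hg hv c
  rw [← funext hF]
  exact hvalue.comp (measurable_id.prodMk F.measurable_act)

theorem abs_bellman_sub_le {v w : m.TState → ℝ} (p : m.TState) {D : ℝ}
    (h : ∀ c ∈ p.2.admissible, |m.actionValue v p c - m.actionValue w p c| ≤ D) :
    |m.bellman v p - m.bellman w p| ≤ D := by
  rw [abs_sub_le_iff, sub_le_iff_le_add', sub_le_iff_le_add']
  refine ⟨m.bellman_le v p fun c hc => ?_, m.bellman_le w p fun c hc => ?_⟩
  · linarith [(abs_sub_le_iff.1 (h c hc)).1, m.actionValue_le_bellman w p hc]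
  · linarith [(abs_sub_le_iff.1 (h c hc)).2, m.actionValue_le_bellman v p hc]

theorem actionValue_sub {v w : m.TState → ℝ} {p : m.TState} {c : Action M}
    (hv : Integrable v (m.Q p c)) (hw : Integrable w (m.Q p c)) :
    m.actionValue v p c - m.actionValue w p c = ∫ q, (v q - w q) ∂(m.Q p c) := by
  rw [actionValue, actionValue, add_sub_add_left_eq_sub, integral_sub hv hw]

namespace IsLyapunov

variable {m} {W : m.TState → ℝ} {κ C : ℝ}

theorem weight_nonneg (hW : m.IsLyapunov W κ C) (p : m.TState) : 0 ≤ W p :=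
  zero_le_one.trans (hW.one_le p)

theorem abs_r_le (hW : m.IsLyapunov W κ C) {p : m.TState} {c : Action M}
    (hc : c ∈ p.2.admissible) : |m.r p c| ≤ C * (m.T + 1) * W p := by
  have hτ : 0 ≤ m.T - p.1 := sub_nonneg.2 p.1.2.2
  have hl : (0 : ℝ) ≤ m.rate p.2 := NNReal.coe_nonneg _
  have hsojourn : meanSojourn (m.rate p.2) (m.T - p.1) ≤ m.T :=
    (meanSojourn_le hl).trans (sub_le_self _ p.1.2.1)
  have hexp : Real.exp (-(m.rate p.2 * (m.T - p.1))) ≤ 1 := by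
    rw [Real.exp_le_one_iff, neg_nonpos]
    positivity
  have := mul_nonneg hW.const_nonneg (hW.weight_nonneg p)
  unfold r
  refine (abs_add_le _ _).trans ?_
  rw [abs_mul, abs_mul, abs_of_nonneg (meanSojourn_nonneg hl hτ), abs_of_nonneg (Real.exp_nonneg _)]
  calc _ ≤ C * W p * m.T + 1 * (C * W p) := by
        gcongr
        exacts [meanSojourn_nonneg hl hτ, hW.running_le p c hc, hW.terminal_le p c hc]
    _ = _ := by ring

theorem lintegral_enorm_Q_le (hW : m.IsLyapunov W κ C) {v : m.TState → ℝ} {D : ℝ} (hD : 0 ≤ D)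
    (hle : ∀ p, |v p| ≤ D * W p) {p : m.TState} {c : Action M} (hc : c ∈ p.2.admissible) :
    ∫⁻ q, ‖v q‖ₑ ∂(m.Q p c) ≤ ENNReal.ofReal (D * (κ * W p)) :=
  lintegral_enorm_le_of_abs_le_mul hD (Filter.Eventually.of_forall hle) (hW.lintegral_le p c hc)

theorem integrable_Q (hW : m.IsLyapunov W κ C) {v : m.TState → ℝ} (hv : WeightBounded W v)
    {p : m.TState} {c : Action M} (hc : c ∈ p.2.admissible) : Integrable v (m.Q p c) := by
  obtain ⟨hmeas, D, hD, hle⟩ := hv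
  exact ⟨hmeas.aestronglyMeasurable,
    (hW.lintegral_enorm_Q_le hD hle hc).trans_lt ENNReal.ofReal_lt_top⟩

theorem abs_bellman_sub_le (hW : m.IsLyapunov W κ C) {v w : m.TState → ℝ}
    (hv : WeightBounded W v) (hw : WeightBounded W w) {D : ℝ} (hD : 0 ≤ D)
    (hle : ∀ p, |v p - w p| ≤ D * W p) (p : m.TState) :
    |m.bellman v p - m.bellman w p| ≤ κ * D * W p := by
  refine m.abs_bellman_sub_le p fun c hc => ?_
  rw [m.actionValue_sub (hW.integrable_Q hv hc) (hW.integrable_Q hw hc)]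
  refine (abs_integral_le_of_lintegral_enorm_le ?_ (hW.lintegral_enorm_Q_le hD hle hc)).trans_eq
    (by ring)
  exact mul_nonneg hD (mul_nonneg hW.nonneg (hW.weight_nonneg p))

theorem abs_bellman_zero_le (hW : m.IsLyapunov W κ C) (p : m.TState) :
    |m.bellman 0 p| ≤ C * (m.T + 1) * W p := by
  have hvalue (c : Action M) : m.actionValue 0 p c = m.r p c := by simp [actionValue]
  obtain ⟨c, hc⟩ := p.2.admissible_nonempty
  refine abs_le.2 ⟨?_, m.bellman_le 0 p fun c hc => ?_⟩
  · exact (abs_le.1 (hW.abs_r_le hc)).1.trans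
      ((hvalue c).symm.trans_le (m.actionValue_le_bellman 0 p hc))
  · exact (hvalue c).trans_le (abs_le.1 (hW.abs_r_le hc)).2

theorem exists_fixedPoint (hW : m.IsLyapunov W κ C) (hf : ∀ a, Measurable fun z => m.f z a)
    (hg : Measurable m.g) (hT : 0 ≤ m.T) : ∃ v, WeightBounded W v ∧ m.bellman v = v :=
  exists_weightBounded_fixedPoint hW.nonneg hW.lt_one
    (fun _ hv => m.measurable_bellman hf hg hv.1)
    ⟨m.measurable_bellman hf hg measurable_zero, _,
      mul_nonneg hW.const_nonneg (by positivity), hW.abs_bellman_zero_le⟩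
    fun _ _ hv hw _ => hW.abs_bellman_sub_le hv hw

end IsLyapunov

end Model

end Bellman

section Uniqueness

theorem Book.normSq_nonneg {K M : ℕ} (z : Book K M) : 0 ≤ z.normSq := by
  have := z.drivenSq_nonneg
  have : 0 ≤ ∑ i, ((z.ask.vol i : ℝ) ^ 2 + (z.bid.vol i : ℝ) ^ 2) :=
    Finset.sum_nonneg fun _ _ => by positivity
  rw [z.normSq_eq]
  positivity

namespace Model

variable {K M : ℕ} (m : Model K M)

theorem bound_pos (γ₀ : ℝ) (p : m.TState) : 0 < m.bound γ₀ p := by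
  have := p.2.normSq_nonneg
  unfold bound
  positivity

theorem mem_weightedSpace_iff {γ₀ : ℝ} {v : m.TState → ℝ} :
    v ∈ m.weightedSpace γ₀ ↔ WeightBounded (m.bound γ₀) v := by
  have hdiv {D : ℝ} {p : m.TState} : |v p| / m.bound γ₀ p ≤ D ↔ |v p| ≤ D * m.bound γ₀ p :=
    div_le_iff₀ (m.bound_pos γ₀ p)
  refine and_congr_right fun _ => ⟨fun ⟨D, hD⟩ => ?_, fun ⟨D, _, hD⟩ => ?_⟩
  · exact ⟨max D 0, le_max_right _ _, fun p =>
      hdiv.1 ((hD (Set.mem_range_self p)).trans (le_max_left _ _))⟩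
  · exact ⟨D, Set.forall_mem_range.2 fun p => hdiv.2 (hD p)⟩

theorem bound_le_weight {γ₀ L η C : ℝ} (hγ₀ : 0 ≤ γ₀)
    (hC : ∀ z : Book K M, 1 + z.normSq ≤ C * z.growth L η) (p : m.TState) :
    m.bound γ₀ p ≤ C * m.weight L η (fun _ => γ₀ * (4 * K + 2) * m.Lam * m.T) p := by
  have := p.2.normSq_nonneg
  have := p.2.shares_nonneg
  have := m.Lam_nonneg
  rw [weight, ← mul_assoc]
  refine mul_le_mul (hC p.2) (Real.exp_le_exp.2 ?_) (Real.exp_nonneg _)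
    (le_trans (by positivity) (hC p.2))
  calc _ = γ₀ * (4 * K + 2) * m.Lam * (1 + p.2.shares) * (m.T - p.1) := rfl
    _ ≤ γ₀ * (4 * K + 2) * m.Lam * (1 + p.2.shares) * m.T := by
        gcongr
        exact sub_le_self _ p.1.2.1
    _ = _ := by ring

theorem weight_le_weight {L η : ℝ} (hL : 0 ≤ L) (hη : 0 ≤ η) {ρ ρ' : ℝ → ℝ} {p : m.TState}
    (h : ρ p.1 ≤ ρ' p.1) : m.weight L η ρ p ≤ m.weight L η ρ' p := by
  have := hL.trans (p.2.le_growth L hη)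
  have := p.2.shares_nonneg
  unfold weight
  gcongr

theorem ae_lt_Q (p : m.TState) (c : Action M) : ∀ᵐ q ∂(m.Q p c), p.1 < q.1 :=
  Measure.quasiMeasurePreserving_fst.ae (m.ae_lt_jumpTime p)

theorem integrable_Q_of_weightBounded {L η ε : ℝ} (hL : 0 ≤ L) (hη : 0 ≤ η) (hε : 0 ≤ ε)
    (hG : ∀ z w : Book K M, z.Near m.stepBound w → w.growth L η ≤ (1 + ε) * z.growth L η)
    {ρ₀ : ℝ} (hρ₀ : 0 ≤ ρ₀) {v : m.TState → ℝ}
    (hv : WeightBounded (m.weight L η fun _ => ρ₀) v) {p : m.TState} {c : Action M}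
    (hc : c ∈ p.2.admissible) : Integrable v (m.Q p c) := by
  obtain ⟨hmeas, D, hD, hle⟩ := hv
  have hweight := m.lintegral_weight_le (κ := (1 + ε) * Real.exp (ρ₀ * (2 * m.stepBound)))
    hL hη hε (by positivity) (fun u => hasDerivAt_const u ρ₀) continuous_const hG hc p.1.2.2 le_rfl
    (fun _ _ => hρ₀) fun u _ => le_of_eq (by ring)
  rw [lintegral_congr fun q => if_pos q.1.2.2] at hweight
  exact ⟨hmeas.aestronglyMeasurable, (lintegral_enorm_le_of_abs_le_mul hD
    (Filter.Eventually.of_forall hle) hweight).trans_lt ENNReal.ofReal_lt_top⟩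

theorem eq_of_bellman_eq_of_contraction {v w : m.TState → ℝ} (hv : m.bellman v = v)
    (hw : m.bellman w = w) {A : Set m.TState}
    (hvi : ∀ p ∈ A, ∀ c ∈ p.2.admissible, Integrable v (m.Q p c))
    (hwi : ∀ p ∈ A, ∀ c ∈ p.2.admissible, Integrable w (m.Q p c))
    (hA : ∀ p ∈ A, ∀ c ∈ p.2.admissible, ∀ᵐ q ∂(m.Q p c), q ∈ A)
    {U : m.TState → ℝ} (hU : ∀ p, 0 ≤ U p) {κ : ℝ} (hκ₀ : 0 ≤ κ) (hκ₁ : κ < 1)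
    (hUQ : ∀ p ∈ A, ∀ c ∈ p.2.admissible,
      ∫⁻ q, ENNReal.ofReal (U q) ∂(m.Q p c) ≤ ENNReal.ofReal (κ * U p))
    {D : ℝ} (hD : 0 ≤ D) (hle : ∀ p ∈ A, |v p - w p| ≤ D * U p) {p : m.TState} (hp : p ∈ A) :
    v p = w p := by
  have hiter (n : ℕ) : ∀ q ∈ A, |v q - w q| ≤ D * κ ^ n * U q := by
    induction n with
    | zero => simpa using hle
    | succ n ih =>
      intro q hq
      rw [← hv, ← hw]
      refine m.abs_bellman_sub_le q fun c hc => ?_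
      rw [m.actionValue_sub (hvi q hq c hc) (hwi q hq c hc)]
      refine (abs_integral_le_of_lintegral_enorm_le
        (mul_nonneg (by positivity) (mul_nonneg hκ₀ (hU q)))
        (lintegral_enorm_le_of_abs_le_mul (by positivity : 0 ≤ D * κ ^ n)
          ((hA q hq c hc).mono ih) (hUQ q hq c hc))).trans_eq ?_
      ring
  have hlim : Filter.Tendsto (fun n : ℕ => D * κ ^ n * U p) Filter.atTop (nhds 0) := by
    simpa using ((tendsto_pow_atTop_nhds_zero_of_lt_one hκ₀ hκ₁).const_mul D).mul_const (U p)
  exact sub_eq_zero.1 (abs_nonpos_iff.1 (ge_of_tendsto' hlim fun n => hiter n p hp))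

section Slices

variable {m} {L η ρ₀ N θ : ℝ} (hL : 0 ≤ L) (hη : 0 ≤ η) (hρ₀ : 0 ≤ ρ₀) (hN : 0 < N)
  (hNle : 4 * m.Lam * Real.exp ((ρ₀ + 1) * (2 * m.stepBound)) ≤ N)
  (hG : ∀ z w : Book K M, z.Near m.stepBound w → w.growth L η ≤ (1 + 1) * z.growth L η)

include hL hη hρ₀ hN hNle hG

theorem lintegral_weight_slice_le (hlam : m.LinearIntensities) (hθ : θ ≤ m.T) {p : m.TState}
    (hp : θ - 1 / N < p.1) (hpθ : p.1 ≤ θ) {c : Action M} (hc : c ∈ p.2.admissible) :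
    ∫⁻ q, (if (q.1 : ℝ) ≤ θ then
        ENNReal.ofReal (m.weight L η (fun u => ρ₀ + N * (θ - u)) q) else 0) ∂(m.Q p c) ≤
      ENNReal.ofReal (1 / 2 * m.weight L η (fun u => ρ₀ + N * (θ - u)) p) := by
  have hderiv (u : ℝ) : HasDerivAt (fun u => ρ₀ + N * (θ - u)) (-N) u :=
    ((((hasDerivAt_id u).const_sub θ).const_mul N).const_add ρ₀).congr_deriv (by ring)
  have hpos (u : ℝ) (hu : u ≤ θ) : 0 ≤ ρ₀ + N * (θ - u) :=
    add_nonneg hρ₀ (mul_nonneg hN.le (sub_nonneg.2 hu))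
  refine m.lintegral_weight_le hL hη zero_le_one (by norm_num) hderiv continuous_const hG hc hpθ hθ
    hpos fun u hu => ?_
  have hslice : N * (θ - u) ≤ 1 := by
    rw [← le_div_iff₀' hN]
    linarith [hu.1]
  have hS := p.2.shares_nonneg
  have hΛ := m.Lam_nonneg
  have hrate : (m.rate p.2 : ℝ) ≤ m.Lam * (1 + p.2.shares) := by
    linarith [m.rate_le hlam p.2]
  have hexp : (m.rate p.2 : ℝ) * Real.exp ((ρ₀ + N * (θ - u)) * (2 * m.stepBound)) ≤
      m.Lam * (1 + p.2.shares) * Real.exp ((ρ₀ + 1) * (2 * m.stepBound)) := by gcongr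
  have := mul_le_mul_of_nonneg_right hNle (by linarith : 0 ≤ 1 + p.2.shares)
  have : (0 : ℝ) ≤ m.rate p.2 := NNReal.coe_nonneg _
  linarith

theorem eq_of_bellman_eq_of_lt (hlam : m.LinearIntensities) (hθ : θ ≤ m.T)
    {v w : m.TState → ℝ} (hv : WeightBounded (m.weight L η fun _ => ρ₀) v)
    (hw : WeightBounded (m.weight L η fun _ => ρ₀) w) (hvfix : m.bellman v = v)
    (hwfix : m.bellman w = w) (heq : ∀ p : m.TState, θ < p.1 → v p = w p) {p : m.TState}
    (hp : θ - 1 / N < p.1) : v p = w p := by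
  set ρ : ℝ → ℝ := fun u => ρ₀ + N * (θ - u)
  set U : m.TState → ℝ := fun q => if (q.1 : ℝ) ≤ θ then m.weight L η ρ q else 0 with hU
  obtain ⟨-, D₁, hD₁, hvle⟩ := id hv
  obtain ⟨-, D₂, hD₂, hwle⟩ := id hw
  have hint {u : m.TState → ℝ} (hu : WeightBounded (m.weight L η fun _ => ρ₀) u) (q : m.TState)
      (_ : θ - 1 / N < q.1) (c : Action M) (hc : c ∈ q.2.admissible) : Integrable u (m.Q q c) :=
    m.integrable_Q_of_weightBounded hL hη zero_le_one hG hρ₀ hu hc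
  refine m.eq_of_bellman_eq_of_contraction (A := {q | θ - 1 / N < q.1}) (κ := 1 / 2) (U := U)
    (D := D₁ + D₂) hvfix hwfix (hint hv) (hint hw)
    (fun q hq c _ => (m.ae_lt_Q q c).mono fun x hx =>
      show θ - 1 / N < x.1 from lt_trans hq hx)
    (fun q => ?_) (by norm_num) (by norm_num) (fun q hq c hc => ?_) (by positivity)
    (fun q _ => ?_) hp
  · simp only [hU]
    split_ifs
    exacts [mul_nonneg (hL.trans (q.2.le_growth L hη)) (Real.exp_nonneg _), le_rfl]
  · by_cases hqθ : (q.1 : ℝ) ≤ θ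
    · simpa only [hU, if_pos hqθ, apply_ite ENNReal.ofReal, ENNReal.ofReal_zero] using
        lintegral_weight_slice_le hL hη hρ₀ hN hNle hG hlam hθ hq hqθ hc
    · have hzero : ∀ᵐ x ∂(m.Q q c), ENNReal.ofReal (U x) = 0 :=
        (m.ae_lt_Q q c).mono fun x hx => by
          simp only [hU, if_neg (not_le.2 ((not_le.1 hqθ).trans hx)), ENNReal.ofReal_zero]
      rw [lintegral_congr_ae hzero, lintegral_zero]
      exact zero_le
  · by_cases hqθ : (q.1 : ℝ) ≤ θ
    · have hmono : m.weight L η (fun _ => ρ₀) q ≤ m.weight L η ρ q :=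
        m.weight_le_weight hL hη
          (le_add_of_nonneg_right (mul_nonneg hN.le (sub_nonneg.2 hqθ)))
      simp only [hU, if_pos hqθ]
      refine ((abs_sub _ _).trans (add_le_add (hvle q) (hwle q))).trans ?_
      rw [← add_mul]
      gcongr
    · simp only [heq q (not_le.1 hqθ), sub_self, abs_zero, hU, if_neg hqθ, mul_zero, le_refl]

theorem eq_of_bellman_eq_of_weightBounded (hlam : m.LinearIntensities) {v w : m.TState → ℝ}
    (hv : WeightBounded (m.weight L η fun _ => ρ₀) v)
    (hw : WeightBounded (m.weight L η fun _ => ρ₀) w) (hvfix : m.bellman v = v)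
    (hwfix : m.bellman w = w) : v = w := by
  have hslices (k : ℕ) : ∀ p : m.TState, m.T - k * (1 / N) < p.1 → v p = w p := by
    induction k with
    | zero => exact fun p hp => absurd p.1.2.2 (not_le.2 (by simpa using hp))
    | succ k ih =>
      refine fun p hp => eq_of_bellman_eq_of_lt (θ := m.T - k * (1 / N)) hL hη hρ₀ hN hNle hG hlam
        (sub_le_self _ (by positivity)) hv hw hvfix hwfix ih ?_
      push_cast at hp
      linarith
  funext p
  obtain ⟨k, hk⟩ := exists_nat_gt (m.T * N)
  refine hslices k p (lt_of_lt_of_le ?_ p.1.2.1)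
  rwa [mul_one_div, sub_neg, lt_div_iff₀ hN]

end Slices

theorem eq_of_bellman_eq (hlam : m.LinearIntensities) (hT : 0 ≤ m.T) {γ₀ : ℝ} (hγ₀ : 0 ≤ γ₀)
    {v w : m.TState → ℝ} (hv : v ∈ m.weightedSpace γ₀) (hw : w ∈ m.weightedSpace γ₀)
    (hvfix : m.bellman v = v) (hwfix : m.bellman w = w) : v = w := by
  obtain ⟨L, η, hL, hη, hG⟩ := Book.exists_growth_le K M m.stepBound (one_pos (α := ℝ))
  obtain ⟨C, hC, hnorm⟩ := Book.exists_normSq_le_growth K M hL hη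
  have := m.Lam_nonneg
  set ρ₀ := γ₀ * (4 * K + 2) * m.Lam * m.T
  have hbound := m.bound_le_weight hγ₀ hnorm
  exact eq_of_bellman_eq_of_weightBounded
    (N := 4 * m.Lam * Real.exp ((ρ₀ + 1) * (2 * m.stepBound)) + 1) (zero_le_one.trans hL) hη.le
    (by positivity) (by positivity) (by linarith) hG hlam
    ((m.mem_weightedSpace_iff.1 hv).mono hC.le hbound)
    ((m.mem_weightedSpace_iff.1 hw).mono hC.le hbound) hvfix hwfix

end Model

end Uniqueness

/-! ## The controlled chain -/

section Trajectory

variable {X : ℕ → Type*} [∀ n, MeasurableSpace (X n)]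
  (κ : (n : ℕ) → Kernel (Π i : Finset.Iic n, X i) (X (n + 1))) [∀ n, IsMarkovKernel (κ n)]
  {a n : ℕ} (x₀ : Π i : Finset.Iic a, X i)

theorem map_traj_succ (han : a ≤ n) :
    (Kernel.traj κ a x₀).map (fun ω => (Preorder.frestrictLe n ω, ω (n + 1))) =
      (Kernel.traj κ a x₀).map (Preorder.frestrictLe n) ⊗ₘ κ n := by
  rw [Kernel.traj_map_frestrictLe_apply]
  exact (Kernel.partialTraj_compProd_eq_map_traj han).symm

theorem lintegral_traj_succ (han : a ≤ n) {H : (Π i : Finset.Iic n, X i) × X (n + 1) → ℝ≥0∞}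
    (hH : Measurable H) :
    ∫⁻ ω, H (Preorder.frestrictLe n ω, ω (n + 1)) ∂Kernel.traj κ a x₀ =
      ∫⁻ ω, ∫⁻ x, H (Preorder.frestrictLe n ω, x) ∂κ n (Preorder.frestrictLe n ω)
        ∂Kernel.traj κ a x₀ := by
  rw [← lintegral_map hH (by fun_prop), map_traj_succ κ x₀ han, Measure.lintegral_compProd hH,
    lintegral_map hH.lintegral_kernel_prod_right' (by fun_prop)]

theorem integral_traj_succ {E : Type*} [NormedAddCommGroup E] [NormedSpace ℝ E] (han : a ≤ n)
    {H : (Π i : Finset.Iic n, X i) × X (n + 1) → E} (hH : StronglyMeasurable H)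
    (hi : Integrable (fun ω => H (Preorder.frestrictLe n ω, ω (n + 1))) (Kernel.traj κ a x₀)) :
    ∫ ω, H (Preorder.frestrictLe n ω, ω (n + 1)) ∂Kernel.traj κ a x₀ =
      ∫ ω, ∫ x, H (Preorder.frestrictLe n ω, x) ∂κ n (Preorder.frestrictLe n ω)
        ∂Kernel.traj κ a x₀ := by
  have hmap : Measurable fun ω : Π i, X i => (Preorder.frestrictLe n ω, ω (n + 1)) := by fun_prop
  have hi' : Integrable H ((Kernel.traj κ a x₀).map (Preorder.frestrictLe n) ⊗ₘ κ n) := by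
    rw [← map_traj_succ κ x₀ han]
    exact (integrable_map_measure hH.aestronglyMeasurable hmap.aemeasurable).2 hi
  rw [← integral_map hmap.aemeasurable hH.aestronglyMeasurable, map_traj_succ κ x₀ han,
    Measure.integral_compProd hi', integral_map (by fun_prop)
      hH.integral_kernel_prod_right'.aestronglyMeasurable]

theorem ae_traj_succ (han : a ≤ n) {P : (Π i : Finset.Iic n, X i) × X (n + 1) → Prop}
    (hP : MeasurableSet {q | P q}) (h : ∀ y, ∀ᵐ x ∂κ n y, P (y, x)) :
    ∀ᵐ ω ∂Kernel.traj κ a x₀, P (Preorder.frestrictLe n ω, ω (n + 1)) := by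
  have hmap : Measurable fun ω : Π i, X i => (Preorder.frestrictLe n ω, ω (n + 1)) := by fun_prop
  refine (ae_map_iff hmap.aemeasurable hP).1 ?_
  rw [map_traj_succ κ x₀ han, Measure.ae_compProd_iff hP]
  exact .of_forall h

theorem ae_traj_self [∀ n, MeasurableSingletonClass (X n)] :
    ∀ᵐ ω ∂Kernel.traj κ a x₀, Preorder.frestrictLe a ω = x₀ := by
  refine ae_of_ae_map (p := fun y => y = x₀) (by fun_prop) ?_
  rw [Kernel.traj_map_frestrictLe_apply, Kernel.partialTraj_self, Kernel.id_apply]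
  exact (ae_dirac_iff (measurableSet_singleton x₀)).2 rfl

end Trajectory

instance {K M : ℕ} : MeasurableSingletonClass (Book K M) :=
  ⟨fun _ => (Book.measurableEquivProd K M).measurableEmbedding.measurableSet_image.1 <|
    Set.image_singleton ▸ measurableSet_singleton _⟩

namespace Model

variable {K M : ℕ} (m : Model K M)

instance : MeasurableSingletonClass m.XState := by
  refine ⟨?_⟩
  rintro (q | q)
  · exact Set.image_singleton ▸ measurableSet_inl_image.2 (measurableSet_singleton q)
  · exact Set.image_singleton ▸ measurableSet_inr_image.2 (measurableSet_singleton q)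

section Step

variable (p : m.TState) (c : Action M)

instance : IsFiniteMeasure (m.Q p c) := ⟨(m.Q_univ_le p c).trans_lt ENNReal.one_lt_top⟩

theorem lintegral_stepX_inl {φ : m.XState → ℝ≥0∞} (hφ : Measurable φ) :
    ∫⁻ x, φ x ∂m.stepX (Sum.inl p) c = ∫⁻ q, φ (Sum.inl q) ∂m.Q p c +
      ENNReal.ofReal (Real.exp (-(m.rate p.2 * (m.T - p.1)))) * φ (Sum.inr ()) := by
  simp only [stepX, step]
  rw [lintegral_add_measure, lintegral_map hφ measurable_inl, lintegral_smul_measure,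
    lintegral_dirac' _ hφ, smul_eq_mul]

theorem integral_stepX_inl {φ : m.XState → ℝ} (hφ : Measurable φ)
    (hi : Integrable (fun q => φ (Sum.inl q)) (m.Q p c)) :
    ∫ x, φ x ∂m.stepX (Sum.inl p) c = ∫ q, φ (Sum.inl q) ∂m.Q p c +
      Real.exp (-(m.rate p.2 * (m.T - p.1))) * φ (Sum.inr ()) := by
  simp only [stepX, step]
  rw [integral_add_measure, integral_map measurable_inl.aemeasurable hφ.aestronglyMeasurable,
    integral_smul_measure, integral_dirac, ENNReal.toReal_ofReal (Real.exp_pos _).le, smul_eq_mul]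
  · exact (integrable_map_measure hφ.aestronglyMeasurable measurable_inl.aemeasurable).2 hi
  · exact (integrable_dirac (by simp)).smul_measure ENNReal.ofReal_ne_top

end Step

variable {m}

/-- The decision in force between the `n`-th and the `(n+1)`-th jump of the trajectory `ω`. -/
def Strategy.decision (π : m.Strategy) (n : ℕ) (ω : ℕ → m.XState) : Action M :=
  π.act n fun i => ω i

theorem Strategy.measurable_decision (π : m.Strategy) (n : ℕ) : Measurable (π.decision n) :=
  (π.measurable_act n).comp (measurable_pi_lambda _ fun _ => measurable_pi_apply _)

theorem Strategy.decision_mem_admissible (π : m.Strategy) {n : ℕ} {ω : ℕ → m.XState}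
    {q : m.TState} (hq : ω n = Sum.inl q) : π.decision n ω ∈ q.2.admissible :=
  π.admissible n _ q hq

section Law

variable (π : m.Strategy) (p : m.TState) (n : ℕ)

instance : IsProbabilityMeasure (m.law π p) :=
  inferInstanceAs (IsProbabilityMeasure (Kernel.traj (X := fun _ => m.XState) (m.kernel π) 0 _))

theorem measurable_act_prod {E : Type*} [MeasurableSpace E]
    {H : (m.XState × Action M) × m.XState → E} (hH : Measurable H) :
    Measurable fun q : m.Hist n × m.XState =>
      H ((q.1 ⟨n, Finset.mem_Iic.2 le_rfl⟩, π.act n q.1), q.2) :=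
  have := π.measurable_act n
  hH.comp (by fun_prop)

theorem lintegral_law_succ {H : (m.XState × Action M) × m.XState → ℝ≥0∞} (hH : Measurable H) :
    ∫⁻ ω, H ((ω n, π.decision n ω), ω (n + 1)) ∂m.law π p =
      ∫⁻ ω, ∫⁻ x, H ((ω n, π.decision n ω), x) ∂m.stepX (ω n) (π.decision n ω) ∂m.law π p :=
  lintegral_traj_succ (X := fun _ => m.XState) (m.kernel π) _ n.zero_le
    (measurable_act_prod π n hH)

theorem integral_law_succ {H : (m.XState × Action M) × m.XState → ℝ} (hH : Measurable H)
    (hi : Integrable (fun ω => H ((ω n, π.decision n ω), ω (n + 1))) (m.law π p)) :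
    ∫ ω, H ((ω n, π.decision n ω), ω (n + 1)) ∂m.law π p =
      ∫ ω, ∫ x, H ((ω n, π.decision n ω), x) ∂m.stepX (ω n) (π.decision n ω) ∂m.law π p :=
  integral_traj_succ (X := fun _ => m.XState) (m.kernel π) _ n.zero_le
    (measurable_act_prod π n hH).stronglyMeasurable hi

theorem ae_law_succ {P : m.XState → m.XState → Prop} (hP : MeasurableSet {q : _ × _ | P q.1 q.2})
    (h : ∀ x c, ∀ᵐ x' ∂m.stepX x c, P x x') : ∀ᵐ ω ∂m.law π p, P (ω n) (ω (n + 1)) := by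
  have hmeas : Measurable fun q : m.Hist n × m.XState =>
      (q.1 ⟨n, Finset.mem_Iic.2 le_rfl⟩, q.2) := by fun_prop
  exact ae_traj_succ (X := fun _ => m.XState) (m.kernel π) _ n.zero_le
    (P := fun q => P (q.1 ⟨n, Finset.mem_Iic.2 le_rfl⟩) q.2) (hmeas hP) fun _ => h _ _

theorem ae_law_zero : ∀ᵐ ω ∂m.law π p, ω 0 = Sum.inl p :=
  (ae_traj_self (X := fun _ => m.XState) (m.kernel π) fun _ => Sum.inl p).mono fun _ hω =>
    congr_fun hω ⟨0, Finset.mem_Iic.2 le_rfl⟩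

end Law

end Model

/-! ## Verification -/

namespace Model

variable {K M : ℕ} {m : Model K M}

/-- A function on `[0,T] × E`, extended by zero to the cemetery. -/
def zeroExt (v : m.TState → ℝ) : m.XState → ℝ := Sum.elim v fun _ => 0

theorem measurable_zeroExt {v : m.TState → ℝ} (hv : Measurable v) : Measurable (zeroExt v) :=
  hv.sumElim measurable_const

/-- `u(Tₙ, Zₙ, αₙ)`, zero at the cemetery, where `αₙ` is the decision taken at the `n`-th jump. -/
def Strategy.stage (π : m.Strategy) (u : m.TState → Action M → ℝ) (n : ℕ) (ω : ℕ → m.XState) : ℝ :=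
  zeroExt (fun q => u q (π.decision n ω)) (ω n)

theorem Strategy.measurable_stage (π : m.Strategy) {u : m.TState → Action M → ℝ}
    (hu : ∀ c, Measurable fun q => u q c) (n : ℕ) : Measurable (π.stage u n) := by
  have h : Measurable fun q : m.XState × Action M => zeroExt (fun p => u p q.2) q.1 :=
    measurable_from_prod_countable_left fun c => measurable_zeroExt (hu c)
  exact h.comp (f := fun ω : ℕ → m.XState => (ω n, π.decision n ω))
    ((measurable_pi_apply n).prodMk (π.measurable_decision n))

theorem stage_toStrategy (F : m.Policy) : F.toStrategy.stage m.r = m.stageReward F := by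
  funext n ω
  rcases h : ω n with q | _ <;>
    simp [Strategy.stage, Strategy.decision, Policy.toStrategy, stageReward, zeroExt, h]

/-- The expected total reward of a strategy in the Markov decision process. -/
noncomputable def Strategy.totalReward (π : m.Strategy) (p : m.TState) : ℝ :=
  ∫ ω, ∑' n, π.stage m.r n ω ∂m.law π p

theorem totalReward_toStrategy (F : m.Policy) : F.toStrategy.totalReward = m.mdpReward F := by
  funext p
  rw [Strategy.totalReward, stage_toStrategy, mdpReward]

/-- Functionals of the chain, the `n`-th of which is at most a multiple of the weight of the state
reached at the `n`-th jump. -/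
def ChainBounded (W : m.TState → ℝ) (U : ℕ → (ℕ → m.XState) → ℝ) : Prop :=
  (∀ n, Measurable (U n)) ∧ ∃ D, 0 ≤ D ∧ ∀ n ω, |U n ω| ≤ D * zeroExt W (ω n)

theorem Strategy.chainBounded_stage (π : m.Strategy) {W : m.TState → ℝ}
    {u : m.TState → Action M → ℝ} (hu : ∀ c, Measurable fun q => u q c) {D : ℝ} (hD : 0 ≤ D)
    (hle : ∀ p, ∀ c ∈ p.2.admissible, |u p c| ≤ D * W p) : ChainBounded W (π.stage u) := by
  refine ⟨π.measurable_stage hu, D, hD, fun n ω => ?_⟩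
  rcases h : ω n with q | _
  · simpa only [stage, zeroExt, h, Sum.elim_inl] using hle q _ (π.decision_mem_admissible h)
  · simp [stage, zeroExt, h]

theorem Strategy.chainBounded_value (π : m.Strategy) {W v : m.TState → ℝ}
    (hv : WeightBounded W v) : ChainBounded W (π.stage fun q _ => v q) := by
  obtain ⟨hmeas, D, hD, hle⟩ := hv
  exact π.chainBounded_stage (fun _ => hmeas) hD fun q _ _ => hle q

theorem integral_law_zero (π : m.Strategy) (p : m.TState) (φ : m.XState → ℝ) :
    ∫ ω, φ (ω 0) ∂m.law π p = φ (Sum.inl p) := by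
  have h : (fun ω => φ (ω 0)) =ᵐ[m.law π p] fun _ => φ (Sum.inl p) :=
    (ae_law_zero π p).mono fun _ => congr_arg φ
  simp [integral_congr_ae h]

namespace IsLyapunov

variable {W : m.TState → ℝ} {κ C : ℝ} (hW : m.IsLyapunov W κ C)

include hW

theorem lintegral_stepX_le {x : m.XState} {c : Action M}
    (hc : ∀ q, x = Sum.inl q → c ∈ q.2.admissible) :
    ∫⁻ x', ENNReal.ofReal (zeroExt W x') ∂m.stepX x c ≤
      ENNReal.ofReal κ * ENNReal.ofReal (zeroExt W x) := by
  have hmeas : Measurable fun x' => ENNReal.ofReal (zeroExt W x') :=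
    (measurable_zeroExt hW.measurable).ennreal_ofReal
  rcases x with q | _
  · rw [m.lintegral_stepX_inl q c hmeas, ← ENNReal.ofReal_mul hW.nonneg]
    simpa [zeroExt] using hW.lintegral_le q c (hc q rfl)
  · simp only [stepX]
    rw [lintegral_dirac' _ hmeas]
    simp [zeroExt]

theorem lintegral_law_le (π : m.Strategy) (p : m.TState) (n : ℕ) :
    ∫⁻ ω, ENNReal.ofReal (zeroExt W (ω n)) ∂m.law π p ≤ ENNReal.ofReal (κ ^ n * W p) := by
  have hmeas : Measurable fun x : m.XState => ENNReal.ofReal (zeroExt W x) :=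
    (measurable_zeroExt hW.measurable).ennreal_ofReal
  induction n with
  | zero =>
    have h : (fun ω => ENNReal.ofReal (zeroExt W (ω 0))) =ᵐ[m.law π p]
        fun _ => ENNReal.ofReal (W p) := (ae_law_zero π p).mono fun ω hω => by simp [hω, zeroExt]
    simp [lintegral_congr_ae h]
  | succ n ih =>
    rw [lintegral_law_succ π p n (H := fun q => ENNReal.ofReal (zeroExt W q.2))
      (hmeas.comp measurable_snd)]
    calc _ ≤ ∫⁻ ω, ENNReal.ofReal κ * ENNReal.ofReal (zeroExt W (ω n)) ∂m.law π p :=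
          lintegral_mono fun ω => hW.lintegral_stepX_le fun _ => π.decision_mem_admissible
      _ ≤ ENNReal.ofReal κ * ENNReal.ofReal (κ ^ n * W p) := by
          rw [lintegral_const_mul' _ _ ENNReal.ofReal_ne_top]
          gcongr
      _ = ENNReal.ofReal (κ ^ (n + 1) * W p) := by
          rw [← ENNReal.ofReal_mul hW.nonneg, pow_succ', mul_assoc]

section ChainBounded

variable {U : ℕ → (ℕ → m.XState) → ℝ} (hU : ChainBounded W U) (π : m.Strategy) (p : m.TState)

include hU

theorem tsum_lintegral_enorm_lt_top : ∑' n, ∫⁻ ω, ‖U n ω‖ₑ ∂m.law π p < ⊤ := by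
  obtain ⟨-, D, hD, hle⟩ := hU
  have hgeom : Summable fun n : ℕ => D * (κ ^ n * W p) :=
    ((summable_geometric_of_lt_one hW.nonneg hW.lt_one).mul_right (W p)).mul_left D
  refine (ENNReal.tsum_le_tsum fun n => ?_).trans_lt hgeom.tsum_ofReal_lt_top
  exact lintegral_enorm_le_of_abs_le_mul hD (.of_forall (hle n)) (hW.lintegral_law_le π p n)

theorem lintegral_tsum_enorm_lt_top : ∫⁻ ω, ∑' n, ‖U n ω‖ₑ ∂m.law π p < ⊤ := by
  rw [lintegral_tsum fun n => (hU.1 n).enorm.aemeasurable]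
  exact hW.tsum_lintegral_enorm_lt_top hU π p

theorem integrable_law (n : ℕ) : Integrable (U n) (m.law π p) :=
  ⟨(hU.1 n).aestronglyMeasurable,
    (ENNReal.le_tsum n).trans_lt (hW.tsum_lintegral_enorm_lt_top hU π p)⟩

theorem integrable_tsum_law : Integrable (fun ω => ∑' n, U n ω) (m.law π p) :=
  ⟨(Measurable.tsum hU.1).aestronglyMeasurable,
    (lintegral_mono fun _ => enorm_tsum_le_tsum_enorm).trans_lt
      (hW.lintegral_tsum_enorm_lt_top hU π p)⟩

theorem hasSum_integral_law :
    HasSum (fun n => ∫ ω, U n ω ∂m.law π p) (∫ ω, ∑' n, U n ω ∂m.law π p) := by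
  refine hasSum_integral_of_summable_integral_norm (hW.integrable_law hU π p) ?_
  simp only [integral_norm_eq_lintegral_enorm (hU.1 _).aestronglyMeasurable]
  exact ENNReal.summable_toReal (hW.tsum_lintegral_enorm_lt_top hU π p).ne

end ChainBounded

theorem chainBounded_reward (hf : ∀ a, Measurable fun z => m.f z a) (hg : Measurable m.g)
    (hT : 0 ≤ m.T) (π : m.Strategy) : ChainBounded W (π.stage m.r) :=
  π.chainBounded_stage (m.measurable_r hf hg) (mul_nonneg hW.const_nonneg (by positivity))
    fun _ _ => hW.abs_r_le

section Verification

variable {v : m.TState → ℝ} (hv : WeightBounded W v) (π : m.Strategy)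

include hv

theorem chainBounded_next : ChainBounded W (π.stage fun q c => ∫ q', v q' ∂m.Q q c) := by
  obtain ⟨hmeas, D, hD, hle⟩ := hv
  refine π.chainBounded_stage
    (fun c => (hmeas.stronglyMeasurable.integral_kernel (κ := m.kernelQ c)).measurable)
    (mul_nonneg hD hW.nonneg) fun q c hc => ?_
  rw [mul_assoc]
  exact abs_integral_le_of_lintegral_enorm_le
    (mul_nonneg hD (mul_nonneg hW.nonneg (hW.weight_nonneg q)))
    (hW.lintegral_enorm_Q_le hD hle hc)

theorem integral_stage_next (p : m.TState) (n : ℕ) :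
    ∫ ω, π.stage (fun q c => ∫ q', v q' ∂m.Q q c) n ω ∂m.law π p =
      ∫ ω, π.stage (fun q _ => v q) (n + 1) ω ∂m.law π p := by
  have hmeas := measurable_zeroExt hv.1
  refine Eq.trans (integral_congr_ae (.of_forall fun ω => ?_))
    (integral_law_succ π p n (H := fun q => zeroExt v q.2) (hmeas.comp measurable_snd)
      (hW.integrable_law (π.chainBounded_value hv) π p (n + 1))).symm
  rcases h : ω n with q | _
  · simp only [Strategy.stage, h]
    rw [m.integral_stepX_inl q _ hmeas (hW.integrable_Q hv (π.decision_mem_admissible h))]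
    simp [zeroExt]
  · simp [Strategy.stage, h, zeroExt, stepX]

-- The expected values of `v` along the chain telescope from `v p` to zero.
theorem hasSum_integral_loss (hf : ∀ a, Measurable fun z => m.f z a) (hg : Measurable m.g)
    (hT : 0 ≤ m.T) (p : m.TState) :
    HasSum (fun n => ∫ ω, π.stage (fun q c => v q - m.actionValue v q c) n ω ∂m.law π p)
      (v p - π.totalReward p) := by
  have hreward := hW.chainBounded_reward hf hg hT π
  have hvalue := π.chainBounded_value hv
  have hnext := hW.chainBounded_next hv π
  have hsum := hW.hasSum_integral_law hvalue π p
  have hsum_next := (hasSum_nat_add_iff' 1).2 hsum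
  have hstart : ∫ ω, π.stage (fun q _ => v q) 0 ω ∂m.law π p = v p :=
    integral_law_zero π p (zeroExt v)
  simp only [← hW.integral_stage_next hv, Finset.sum_range_one, hstart] at hsum_next
  have hloss (n : ℕ) : π.stage (fun q c => v q - m.actionValue v q c) n =
      π.stage (fun q _ => v q) n - π.stage (fun q c => ∫ q', v q' ∂m.Q q c) n -
        π.stage m.r n := by
    funext ω
    simp only [Pi.sub_apply, Strategy.stage]
    rcases ω n with q | _ <;> simp only [zeroExt, Sum.elim_inl, Sum.elim_inr, actionValue] <;> ring
  have hintegral (n : ℕ) : ∫ ω, π.stage (fun q c => v q - m.actionValue v q c) n ω ∂m.law π p =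
      ∫ ω, π.stage (fun q _ => v q) n ω ∂m.law π p -
        ∫ ω, π.stage (fun q c => ∫ q', v q' ∂m.Q q c) n ω ∂m.law π p -
        ∫ ω, π.stage m.r n ω ∂m.law π p := by
    have hv_integrable := hW.integrable_law hvalue π p n
    have hnext_integrable := hW.integrable_law hnext π p n
    rw [hloss, integral_sub' (hv_integrable.sub hnext_integrable)
      (hW.integrable_law hreward π p n), integral_sub' hv_integrable hnext_integrable]
  have hsub := (hsum.sub hsum_next).sub (hW.hasSum_integral_law hreward π p)
  rw [sub_sub_cancel] at hsub
  simp only [hintegral]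
  exact hsub

theorem totalReward_le (hf : ∀ a, Measurable fun z => m.f z a) (hg : Measurable m.g)
    (hT : 0 ≤ m.T) (hfix : m.bellman v = v) (p : m.TState) : π.totalReward p ≤ v p := by
  refine sub_nonneg.1 ((hW.hasSum_integral_loss hv π hf hg hT p).nonneg fun n =>
    integral_nonneg fun ω => ?_)
  rcases h : ω n with q | _
  · simp only [Strategy.stage, h, zeroExt, Sum.elim_inl, Pi.zero_apply, sub_nonneg]
    exact (m.actionValue_le_bellman v q (π.decision_mem_admissible h)).trans_eq (congr_fun hfix q)
  · simp [Strategy.stage, h, zeroExt]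

end Verification

theorem totalReward_of_isMaximizer (hf : ∀ a, Measurable fun z => m.f z a) (hg : Measurable m.g)
    (hT : 0 ≤ m.T) {v : m.TState → ℝ} (hv : WeightBounded W v) (hfix : m.bellman v = v)
    {F : m.DecisionRule} (hF : m.IsMaximizer v F) (p : m.TState) :
    (Policy.toStrategy fun _ => F).totalReward p = v p := by
  have hloss := hW.hasSum_integral_loss hv (Policy.toStrategy fun _ => F) hf hg hT p
  have hzero : ∀ n ω, (Policy.toStrategy fun _ => F).stage
      (fun q c => v q - m.actionValue v q c) n ω = 0 := fun n ω => by
    rcases h : ω n with q | _ <;>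
      simp [Strategy.stage, Strategy.decision, Policy.toStrategy, zeroExt, h, hF _, hfix]
  simp only [hzero, integral_zero] at hloss
  exact (sub_eq_zero.1 (hloss.unique hasSum_zero)).symm

end IsLyapunov

end Model

/-! ## The gain in continuous time -/

namespace Model

theorem integral_exp_mul_sub {l : ℝ} (hl : l ≠ 0) (t T : ℝ) :
    ∫ u in t..T, l * Real.exp (-(l * (u - t))) * (u - t) =
      meanSojourn l (T - t) - Real.exp (-(l * (T - t))) * (T - t) := by
  have hc : Continuous fun u : ℝ => l * Real.exp (-(l * (u - t))) * (u - t) := by fun_prop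
  rw [intervalIntegral.integral_eq_sub_of_hasDerivAt
    (f := fun u => -Real.exp (-(l * (u - t))) / l - Real.exp (-(l * (u - t))) * (u - t)) _
    (hc.intervalIntegrable _ _)]
  · rw [meanSojourn, if_neg hl]
    simp only [sub_self, mul_zero, neg_zero, Real.exp_zero]
    ring
  · intro u _
    have hsub : HasDerivAt (fun u => u - t) 1 u := (hasDerivAt_id u).sub_const t
    have hexp : HasDerivAt (fun u => Real.exp (-(l * (u - t))))
        (Real.exp (-(l * (u - t))) * -(l * 1)) u := (hsub.const_mul l).neg.exp
    refine ((hexp.neg.div_const l).sub (hexp.mul hsub)).congr_deriv ?_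
    field_simp
    ring

theorem exp_mul_le_meanSojourn {l τ : ℝ} (hl : 0 ≤ l) :
    Real.exp (-(l * τ)) * τ ≤ meanSojourn l τ := by
  rcases hl.eq_or_lt with rfl | hl
  · simp [meanSojourn]
  · rw [meanSojourn, if_neg hl.ne', ← sub_div, le_div_iff₀ hl, Real.exp_neg]
    field_simp
    linarith [Real.add_one_le_exp (l * τ)]

variable {K M : ℕ} (m : Model K M)

theorem lintegral_Q_sub (p : m.TState) (c : Action M) :
    ∫⁻ q, ENNReal.ofReal (q.1 - p.1) ∂m.Q p c = ENNReal.ofReal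
      (meanSojourn (m.rate p.2) (m.T - p.1) -
        Real.exp (-(m.rate p.2 * (m.T - p.1))) * (m.T - p.1)) := by
  have hmeas : Measurable fun u : ℝ => ENNReal.ofReal (u - p.1) := by fun_prop
  have hpT : (p.1 : ℝ) ≤ m.T := p.1.2.2
  rw [Q, lintegral_prod _ (by fun_prop)]
  simp only [lintegral_const]
  rw [lintegral_mul_const _ (by fun_prop)]
  by_cases hl : m.rate p.2 = 0
  · simp [jumpGoal, hl, meanSojourn]
  rw [m.jumpGoal_univ _ _ hl, mul_one, m.lintegral_jumpTime p hmeas,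
    ← integral_exp_mul_sub (NNReal.coe_ne_zero.2 hl), intervalIntegral.integral_of_le hpT,
    ofReal_integral_eq_lintegral_ofReal]
  · refine setLIntegral_congr_fun measurableSet_Ioc fun u _ => ?_
    rw [← ENNReal.ofReal_mul (by positivity)]
  · exact Continuous.integrableOn_Icc (by fun_prop) |>.mono_set Set.Ioc_subset_Icc_self
  · refine (ae_restrict_iff' measurableSet_Ioc).2 (.of_forall fun u hu => ?_)
    have : 0 ≤ u - p.1 := sub_nonneg.2 hu.1.le
    positivity

theorem integral_Q_sub (p : m.TState) (c : Action M) :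
    ∫ q, ((q.1 : ℝ) - p.1) ∂m.Q p c = meanSojourn (m.rate p.2) (m.T - p.1) -
      Real.exp (-(m.rate p.2 * (m.T - p.1))) * (m.T - p.1) := by
  rw [integral_eq_lintegral_of_nonneg_ae _ (by fun_prop), m.lintegral_Q_sub,
    ENNReal.toReal_ofReal (sub_nonneg.2 (exp_mul_le_meanSojourn (NNReal.coe_nonneg _)))]
  exact (m.ae_lt_Q p c).mono fun q hq => sub_nonneg.2 (Subtype.coe_le_coe.2 hq.le)

/-- The time of a jump, read as the horizon at the cemetery. -/
def time : m.XState → ℝ := Sum.elim (fun q => (q.1 : ℝ)) fun _ => m.T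

/-- The indicator of the cemetery. -/
def dead : m.XState → ℝ := Sum.elim (fun _ => 0) fun _ => 1

/-- The running reward rate under the decision `c`, zero at the cemetery. -/
def running (c : Action M) : m.XState → ℝ := zeroExt fun q => m.f (q.2.place c) c

/-- The terminal reward under the decision `c`, zero at the cemetery. -/
def terminal (c : Action M) : m.XState → ℝ := zeroExt fun q => m.g (q.2.place c)

/-- The reward collected under the decision `c` between two successive states of the chain: a
transition to the cemetery means that no further jump occurs before the horizon. -/
def jumpGain (c : Action M) (x x' : m.XState) : ℝ :=
  m.running c x * (m.time x' - m.time x) + m.terminal c x * m.dead x'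

@[fun_prop]
theorem measurable_time : Measurable m.time :=
  (measurable_subtype_coe.comp measurable_fst).sumElim measurable_const

@[fun_prop]
theorem measurable_dead : Measurable m.dead :=
  measurable_const.sumElim measurable_const

theorem measurable_jumpGain (hf : ∀ a, Measurable fun z => m.f z a) (hg : Measurable m.g) :
    Measurable fun q : (m.XState × Action M) × m.XState => m.jumpGain q.1.2 q.1.1 q.2 := by
  have h : Measurable fun q : (m.XState × m.XState) × Action M => m.jumpGain q.2 q.1.1 q.1.2 := by
    refine measurable_from_prod_countable_left fun c => ?_
    have hplace : Measurable fun q : m.TState => q.2.place c :=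
      (measurable_place c).comp measurable_snd
    have hrunning : Measurable (m.running c) := measurable_zeroExt ((hf c).comp hplace)
    have hterminal : Measurable (m.terminal c) := measurable_zeroExt (hg.comp hplace)
    simp only [jumpGain]
    fun_prop
  exact h.comp (f := fun q : (m.XState × Action M) × m.XState => ((q.1.1, q.2), q.1.2))
    (by fun_prop)

theorem integral_jumpGain (p : m.TState) (c : Action M) :
    ∫ x, m.jumpGain c (Sum.inl p) x ∂m.stepX (Sum.inl p) c = m.r p c := by
  have hmeas : Measurable (m.jumpGain c (Sum.inl p)) := by
    unfold jumpGain
    fun_prop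
  have hsojourn : Integrable (fun q : m.TState => (q.1 : ℝ) - p.1) (m.Q p c) := by
    refine Integrable.of_bound (by fun_prop) m.T (.of_forall fun q => ?_)
    rw [Real.norm_eq_abs, abs_le]
    constructor <;> linarith [q.1.2.1, q.1.2.2, p.1.2.1, p.1.2.2]
  rw [m.integral_stepX_inl p c hmeas]
  · simp only [jumpGain, running, terminal, zeroExt, time, dead, Sum.elim_inl, Sum.elim_inr,
      mul_zero, add_zero, mul_one]
    rw [integral_const_mul, integral_Q_sub, r]
    ring
  · simp only [jumpGain, time, dead, Sum.elim_inl, mul_zero, add_zero]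
    exact hsojourn.const_mul _

variable {m}

/-- The reward collected between the `n`-th and the next jump of the trajectory `ω`. -/
def Strategy.stageGain (π : m.Strategy) (n : ℕ) (ω : ℕ → m.XState) : ℝ :=
  m.jumpGain (π.decision n ω) (ω n) (ω (n + 1))

theorem time_mem_Icc (hT : 0 ≤ m.T) (x : m.XState) : m.time x ∈ Set.Icc 0 m.T := by
  rcases x with q | _
  exacts [q.1.2, ⟨hT, le_rfl⟩]

namespace IsLyapunov

variable {W : m.TState → ℝ} {κ C : ℝ} (hW : m.IsLyapunov W κ C)

include hW

theorem abs_jumpGain_le (hT : 0 ≤ m.T) {x x' : m.XState} {c : Action M}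
    (hc : ∀ q, x = Sum.inl q → c ∈ q.2.admissible) :
    |m.jumpGain c x x'| ≤ C * (m.T + 1) * zeroExt W x := by
  have hΔ : |m.time x' - m.time x| ≤ m.T := by
    rw [abs_le]
    constructor <;>
      linarith [(time_mem_Icc hT x).1, (time_mem_Icc hT x).2, (time_mem_Icc hT x').1,
        (time_mem_Icc hT x').2]
  have hdead : |m.dead x'| ≤ 1 := by rcases x' with _ | _ <;> simp [dead]
  rcases x with q | _
  · have := hW.const_nonneg
    have := hW.weight_nonneg q
    calc _ ≤ |m.f (q.2.place c) c| * |m.time x' - m.time (Sum.inl q)| +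
          |m.g (q.2.place c)| * |m.dead x'| :=
          (abs_add_le _ _).trans_eq (congr_arg₂ _ (abs_mul _ _) (abs_mul _ _))
      _ ≤ C * W q * m.T + C * W q * 1 := by
          gcongr
          · exact hW.running_le q c (hc q rfl)
          · exact hW.terminal_le q c (hc q rfl)
      _ = C * (m.T + 1) * W q := by ring
  · simp [jumpGain, running, terminal, zeroExt]

variable (hf : ∀ a, Measurable fun z => m.f z a) (hg : Measurable m.g) (hT : 0 ≤ m.T)
  (π : m.Strategy)

include hf hg hT

theorem chainBounded_stageGain : ChainBounded W π.stageGain :=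
  ⟨fun n => (m.measurable_jumpGain hf hg).comp
      (f := fun ω : ℕ → m.XState => ((ω n, π.decision n ω), ω (n + 1)))
      (((measurable_pi_apply n).prodMk (π.measurable_decision n)).prodMk (measurable_pi_apply _)),
    C * (m.T + 1), mul_nonneg hW.const_nonneg (by positivity),
    fun _ _ => hW.abs_jumpGain_le hT fun _ => π.decision_mem_admissible⟩

theorem integral_stageGain (p : m.TState) (n : ℕ) :
    ∫ ω, π.stageGain n ω ∂m.law π p = ∫ ω, π.stage m.r n ω ∂m.law π p := by
  refine (integral_law_succ π p n (m.measurable_jumpGain hf hg)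
    (hW.integrable_law (hW.chainBounded_stageGain hf hg hT π) π p n)).trans
    (integral_congr_ae (.of_forall fun ω => ?_))
  rcases h : ω n with q | _
  · simpa [Strategy.stage, h, zeroExt] using m.integral_jumpGain q (π.decision n ω)
  · simp [Strategy.stage, h, jumpGain, running, terminal, zeroExt]

theorem integral_tsum_stageGain (p : m.TState) :
    ∫ ω, ∑' n, π.stageGain n ω ∂m.law π p = π.totalReward p := by
  have hsum := hW.hasSum_integral_law (hW.chainBounded_stageGain hf hg hT π) π p
  simp only [hW.integral_stageGain hf hg hT π p] at hsum
  exact hsum.unique (hW.hasSum_integral_law (hW.chainBounded_reward hf hg hT π) π p)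

end IsLyapunov

end Model

/-! ## Regular trajectories -/

namespace Model

variable {K M : ℕ} {m : Model K M}

/-- The possible transitions of the chain: to the cemetery, or to a later time. As the time of the
cemetery is the horizon, nothing but the cemetery comes after it. -/
def Precedes (x x' : m.XState) : Prop := x' = Sum.inr () ∨ m.time x < m.time x'

theorem measurableSet_precedes : MeasurableSet {q : m.XState × m.XState | Precedes q.1 q.2} :=
  (measurable_snd (measurableSet_singleton _)).union
    (measurableSet_lt (m.measurable_time.comp measurable_fst)
      (m.measurable_time.comp measurable_snd))

theorem ae_precedes_stepX (x : m.XState) (c : Action M) :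
    ∀ᵐ x' ∂m.stepX x c, Precedes x x' := by
  have hmeas : MeasurableSet {x' | Precedes x x'} := measurable_prodMk_left measurableSet_precedes
  rcases x with p | _
  · simp only [stepX, step, ae_add_measure_iff]
    refine ⟨?_, Measure.ae_smul_measure ?_ _⟩
    · rw [ae_map_iff measurable_inl.aemeasurable hmeas]
      exact (m.ae_lt_Q p c).mono fun q hq => .inr (Subtype.coe_lt_coe.2 hq)
    · rw [ae_dirac_iff hmeas]
      exact .inl rfl
  · simp only [stepX]
    rw [ae_dirac_iff hmeas]
    exact .inl rfl

theorem IsLyapunov.ae_exists_eq_inr {W : m.TState → ℝ} {κ C : ℝ} (hW : m.IsLyapunov W κ C)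
    (π : m.Strategy) (p : m.TState) : ∀ᵐ ω ∂m.law π p, ∃ n, ω n = Sum.inr () := by
  have hbdd : ChainBounded W (π.stage fun q _ => W q) :=
    π.chainBounded_stage (fun _ => hW.measurable) zero_le_one fun q _ _ => by
      rw [one_mul, abs_of_nonneg (hW.weight_nonneg q)]
  have hfinite : ∀ᵐ ω ∂m.law π p, ∑' n, ‖π.stage (fun q _ => W q) n ω‖ₑ < ⊤ :=
    ae_lt_top (Measurable.tsum fun n => (hbdd.1 n).enorm)
      (hW.lintegral_tsum_enorm_lt_top hbdd π p).ne
  filter_upwards [hfinite] with ω hω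
  by_contra! halive
  have hone : ∀ n, 1 ≤ ‖π.stage (fun q _ => W q) n ω‖ₑ := fun n => by
    rcases hx : ω n with q | _
    · rw [Strategy.stage, hx, zeroExt, Sum.elim_inl, Real.enorm_of_nonneg (hW.weight_nonneg q)]
      exact ENNReal.one_le_ofReal.2 (hW.one_le q)
    · exact absurd hx (halive n)
  have htop : ∑' _ : ℕ, (1 : ℝ≥0∞) = ⊤ := ENNReal.tsum_const_eq_top_of_ne_zero one_ne_zero
  exact ((ENNReal.tsum_le_tsum hone).trans_lt hω).ne htop

/-- The regular trajectories from `p`: the jump times increase, and there are finitely many jumps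
before the horizon. -/
structure Regular (p : m.TState) (ω : ℕ → m.XState) : Prop where
  start : ω 0 = Sum.inl p
  precedes : ∀ n, Precedes (ω n) (ω (n + 1))
  exists_eq_inr : ∃ n, ω n = Sum.inr ()

theorem IsLyapunov.ae_regular {W : m.TState → ℝ} {κ C : ℝ} (hW : m.IsLyapunov W κ C)
    (π : m.Strategy) (p : m.TState) : ∀ᵐ ω ∂m.law π p, Regular p ω := by
  filter_upwards [ae_law_zero π p, hW.ae_exists_eq_inr π p, ae_all_iff.2 fun n =>
    ae_law_succ π p n measurableSet_precedes ae_precedes_stepX] with ω hstart hfinite hprec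
  exact ⟨hstart, hprec, hfinite⟩

theorem evalAt_eq_zeroExt (π : m.Strategy) (ω : ℕ → m.XState) (s : ℝ) (k : Book K M → ℝ) :
    m.evalAt π ω s k = zeroExt (fun q => k (q.2.place (π.decision (m.jumpCount ω s) ω)))
      (ω (m.jumpCount ω s)) := by
  rw [evalAt]
  split <;> rename_i h <;> rw [h] <;> rfl

namespace Regular

variable {p : m.TState} {ω : ℕ → m.XState} (h : Regular p ω)

include h

theorem eq_inr_succ {n : ℕ} (hn : ω n = Sum.inr ()) : ω (n + 1) = Sum.inr () := by
  rcases h.precedes n with hdead | hlt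
  · exact hdead
  · rcases hx : ω (n + 1) with q | _
    · rw [hn, hx] at hlt
      exact absurd q.1.2.2 hlt.not_ge
    · rfl

theorem eq_inr_of_le {n k : ℕ} (hnk : n ≤ k) (hn : ω n = Sum.inr ()) : ω k = Sum.inr () :=
  Nat.le_induction hn (fun _ _ => h.eq_inr_succ) k hnk

theorem time_mono : Monotone fun n => m.time (ω n) :=
  monotone_nat_of_le_succ fun n => by
    rcases h.precedes n with hdead | hlt
    · rw [hdead]
      rcases ω n with q | _
      exacts [q.1.2.2, le_rfl]
    · exact hlt.le

theorem jumpCount_eq {n : ℕ} {q : m.TState} (hq : ω n = Sum.inl q) {s : ℝ} (hs : q.1 ≤ s)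
    (hs' : ∀ q' : m.TState, ω (n + 1) = Sum.inl q' → s < q'.1) : m.jumpCount ω s = n := by
  refine le_antisymm (Nat.sInf_le hs') (le_csInf ⟨n, hs'⟩ fun k hk => ?_)
  by_contra! hlt
  rcases hx : ω (k + 1) with q' | _
  · have hle : m.time (ω (k + 1)) ≤ m.time (ω n) := h.time_mono hlt
    rw [hx, hq] at hle
    exact ((hk q' hx).trans_le hle).not_ge hs
  · exact Sum.inl_ne_inr (hq.symm.trans (h.eq_inr_of_le hlt hx))

theorem exists_last_jump : ∃ N, (∀ n ≤ N, ∃ q, ω n = Sum.inl q) ∧ ω (N + 1) = Sum.inr () := by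
  classical
  obtain ⟨N, hN⟩ : ∃ N, Nat.find h.exists_eq_inr = N + 1 := by
    refine Nat.exists_eq_succ_of_ne_zero fun hzero => ?_
    have hdead := Nat.find_spec h.exists_eq_inr
    rw [hzero, h.start] at hdead
    exact Sum.inl_ne_inr hdead
  refine ⟨N, fun n hn => ?_, hN ▸ Nat.find_spec h.exists_eq_inr⟩
  rcases hx : ω n with q | _
  · exact ⟨q, rfl⟩
  · exact absurd hx (Nat.find_min h.exists_eq_inr (by omega))

variable (π : m.Strategy)

theorem ae_running_eq (n : ℕ) :
    ∀ᵐ s, s ∈ Set.uIoc (m.time (ω n)) (m.time (ω (n + 1))) →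
      m.running (π.decision n ω) (ω n) = m.evalAt π ω s fun z => m.f z (m.control π ω s) := by
  rw [Set.uIoc_of_le (h.time_mono n.le_succ)]
  filter_upwards [volume.ae_ne (m.time (ω (n + 1)))] with s hne hs
  have hlt : s < m.time (ω (n + 1)) := lt_of_le_of_ne hs.2 hne
  rcases hx : ω n with q | _
  · have hcount : m.jumpCount ω s = n := by
      refine h.jumpCount_eq hx ?_ fun q' hq' => ?_
      · rw [hx] at hs
        exact hs.1.le
      · rwa [hq'] at hlt
    rw [evalAt_eq_zeroExt, control, hcount, hx]
    rfl
  · rw [hx, h.eq_inr_succ hx] at hs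
    exact absurd hs.2 hs.1.not_ge

theorem integral_running {N : ℕ} (hN : ω N = Sum.inr ()) :
    ∫ s in (p.1 : ℝ)..m.T, m.evalAt π ω s (fun z => m.f z (m.control π ω s)) =
      ∑ n ∈ Finset.range N,
        m.running (π.decision n ω) (ω n) * (m.time (ω (n + 1)) - m.time (ω n)) := by
  have hint : ∀ n < N, IntervalIntegrable
      (fun s => m.evalAt π ω s fun z => m.f z (m.control π ω s)) volume
      (m.time (ω n)) (m.time (ω (n + 1))) := fun n _ =>
    intervalIntegrable_const.congr_ae
      ((ae_restrict_iff' measurableSet_uIoc).2 (h.ae_running_eq π n))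
  have hsplit := intervalIntegral.sum_integral_adjacent_intervals (a := fun n => m.time (ω n)) hint
  simp only [h.start, hN] at hsplit
  refine hsplit.symm.trans (Finset.sum_congr rfl fun n _ => ?_)
  rw [← intervalIntegral.integral_congr_ae (h.ae_running_eq π n), intervalIntegral.integral_const,
    smul_eq_mul, mul_comm]

theorem evalAt_horizon {N : ℕ} (halive : ∀ n ≤ N, ∃ q, ω n = Sum.inl q)
    (hN : ω (N + 1) = Sum.inr ()) :
    m.evalAt π ω m.T m.g =
      ∑ n ∈ Finset.range (N + 1), m.terminal (π.decision n ω) (ω n) * m.dead (ω (n + 1)) := by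
  obtain ⟨q, hq⟩ := halive N le_rfl
  have hcount : m.jumpCount ω m.T = N :=
    h.jumpCount_eq hq q.1.2.2 fun _ hq' => absurd (hq'.symm.trans hN) Sum.inl_ne_inr
  have hdead : ∀ n ∈ Finset.range N,
      m.terminal (π.decision n ω) (ω n) * m.dead (ω (n + 1)) = 0 := fun n hn => by
    obtain ⟨q', hq'⟩ := halive (n + 1) (Finset.mem_range.1 hn)
    rw [hq', dead, Sum.elim_inl, mul_zero]
  rw [Finset.sum_range_succ, Finset.sum_eq_zero hdead, zero_add, hN, dead, Sum.elim_inr, mul_one,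
    evalAt_eq_zeroExt, hcount, terminal]

theorem gain_eq : m.gain π p ω = ∑' n, π.stageGain n ω := by
  obtain ⟨N, halive, hN⟩ := h.exists_last_jump
  have hzero : ∀ n ∉ Finset.range (N + 1), π.stageGain n ω = 0 := fun n hn => by
    have hdead := h.eq_inr_of_le (not_lt.1 (mt Finset.mem_range.2 hn)) hN
    simp [Strategy.stageGain, jumpGain, hdead, running, terminal, zeroExt]
  rw [tsum_eq_sum hzero, gain, h.integral_running π hN, h.evalAt_horizon π halive hN,
    ← Finset.sum_add_distrib]
  rfl

end Regular

namespace IsLyapunov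

variable {W : m.TState → ℝ} {κ C : ℝ} (hW : m.IsLyapunov W κ C)
  (hf : ∀ a, Measurable fun z => m.f z a) (hg : Measurable m.g) (hT : 0 ≤ m.T) (π : m.Strategy)
  (p : m.TState)

include hW

theorem gain_ae_eq : m.gain π p =ᵐ[m.law π p] fun ω => ∑' n, π.stageGain n ω :=
  (hW.ae_regular π p).mono fun _ h => h.gain_eq π

include hf hg hT

theorem integrable_gain : Integrable (m.gain π p) (m.law π p) :=
  (hW.integrable_tsum_law (hW.chainBounded_stageGain hf hg hT π) π p).congr
    (hW.gain_ae_eq π p).symm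

theorem expectedGain_eq : m.expectedGain π p = π.totalReward p :=
  (integral_congr_ae (hW.gain_ae_eq π p)).trans (hW.integral_tsum_stageGain hf hg hT π p)

end IsLyapunov

end Model

/-! ## Optimality -/

namespace Model.IsLyapunov

variable {K M : ℕ} {m : Model K M} {W : m.TState → ℝ} {κ C : ℝ} (hW : m.IsLyapunov W κ C)
  (hf : ∀ a, Measurable fun z => m.f z a) (hg : Measurable m.g) (hT : 0 ≤ m.T)

include hW hf hg hT

theorem lintegral_tsum_enorm_stageReward_lt_top (F : m.Policy) (p : m.TState) :
    ∫⁻ ω, ∑' n, ‖m.stageReward F n ω‖ₑ ∂m.law F.toStrategy p < ⊤ := by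
  rw [← stage_toStrategy]
  exact hW.lintegral_tsum_enorm_lt_top (hW.chainBounded_reward hf hg hT F.toStrategy) _ p

variable {v : m.TState → ℝ} (hv : WeightBounded W v) (hfix : m.bellman v = v)

include hv hfix

theorem mdpReward_of_isMaximizer {F : m.DecisionRule} (hF : m.IsMaximizer v F) (p : m.TState) :
    m.mdpReward (fun _ => F) p = v p := by
  rw [← totalReward_toStrategy]
  exact hW.totalReward_of_isMaximizer hf hg hT hv hfix hF p

theorem expectedGain_of_isMaximizer {F : m.DecisionRule} (hF : m.IsMaximizer v F) (p : m.TState) :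
    m.expectedGain (Policy.toStrategy fun _ => F) p = v p :=
  (hW.expectedGain_eq hf hg hT _ p).trans (hW.totalReward_of_isMaximizer hf hg hT hv hfix hF p)

theorem isGreatest_mdpReward (p : m.TState) :
    IsGreatest (Set.range fun F : m.Policy => m.mdpReward F p) (v p) := by
  obtain ⟨F, hF⟩ := m.exists_isMaximizer hf hg hv.1
  refine ⟨⟨fun _ => F, hW.mdpReward_of_isMaximizer hf hg hT hv hfix hF p⟩, ?_⟩
  rintro _ ⟨G, rfl⟩
  exact (congr_fun (totalReward_toStrategy G) p).symm.trans_le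
    (hW.totalReward_le hv G.toStrategy hf hg hT hfix p)

theorem isGreatest_expectedGain (p : m.TState) :
    IsGreatest (Set.range fun π : m.Strategy => m.expectedGain π p) (v p) := by
  obtain ⟨F, hF⟩ := m.exists_isMaximizer hf hg hv.1
  refine ⟨⟨_, hW.expectedGain_of_isMaximizer hf hg hT hv hfix hF p⟩, ?_⟩
  rintro _ ⟨π, rfl⟩
  exact (hW.expectedGain_eq hf hg hT π p).trans_le (hW.totalReward_le hv π hf hg hT hfix p)

end Model.IsLyapunov

end LOB

theorem theorem3p1 {K M : ℕ} (m : LOB.Model K M) (hT : 0 < m.T)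
    (hainf : 0 < m.ainf) (hbinf : 0 < m.binf)
    (hlam : m.LinearIntensities)
    (hf : ∀ a, Measurable fun z => m.f z a) (hg : Measurable m.g)
    (hrew : m.QuadraticRewards) (γ₀ : ℝ) (hγ₀ : 0 < γ₀) :
    ∃ v ∈ m.weightedSpace γ₀,
      -- `v` is the unique fixed point of the maximal reward operator
      m.bellman v = v ∧
      (∀ w ∈ m.weightedSpace γ₀, m.bellman w = w → w = v) ∧
      -- `v` is the value function of the Markov decision process, which is well defined
      (∀ (F : m.Policy) (p : m.TState),
        ∫⁻ ω, ∑' n, ‖m.stageReward F n ω‖ₑ ∂(m.law F.toStrategy p) < ⊤) ∧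
      (∀ p, BddAbove (Set.range fun F : m.Policy => m.mdpReward F p)) ∧
      v = m.Vinf ∧
      -- `v` is the value function of the market making problem, which is well defined
      (∀ (π : m.Strategy) (p : m.TState), MeasureTheory.Integrable (m.gain π p) (m.law π p)) ∧
      (∀ p, BddAbove (Set.range fun π : m.Strategy => m.expectedGain π p)) ∧
      v = m.V ∧
      -- maximizers exist, and each of them gives an optimal stationary policy
      (∃ F : m.DecisionRule, m.IsMaximizer v F) ∧
      (∀ F : m.DecisionRule, m.IsMaximizer v F → ∀ p,
        m.mdpReward (fun _ => F) p = m.Vinf p ∧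
        m.expectedGain (LOB.Model.Policy.toStrategy fun _ => F) p = m.V p) := by
  obtain ⟨W, κ, C, hW, D, hD, hWb⟩ := m.exists_isLyapunov hlam hrew hγ₀
  obtain ⟨v, hv, hfix⟩ := hW.exists_fixedPoint hf hg hT.le
  have hmem : v ∈ m.weightedSpace γ₀ := m.mem_weightedSpace_iff.2 (hv.mono hD hWb)
  have hmdp := hW.isGreatest_mdpReward hf hg hT.le hv hfix
  have hgain := hW.isGreatest_expectedGain hf hg hT.le hv hfix
  have hVinf : v = m.Vinf := funext fun p => (hmdp p).csSup_eq.symm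
  have hV : v = m.V := funext fun p => (hgain p).csSup_eq.symm
  refine ⟨v, hmem, hfix, fun w hw hwfix => m.eq_of_bellman_eq hlam hT.le hγ₀.le hw hmem hwfix hfix,
    hW.lintegral_tsum_enorm_stageReward_lt_top hf hg hT.le, fun p => (hmdp p).bddAbove, hVinf,
    hW.integrable_gain hf hg hT.le, fun p => (hgain p).bddAbove, hV,
    m.exists_isMaximizer hf hg hv.1, fun F hF p => ?_⟩
  rw [← hVinf, ← hV]
  exact ⟨hW.mdpReward_of_isMaximizer hf hg hT.le hv hfix hF p,
    hW.expectedGain_of_isMaximizer hf hg hT.le hv hfix hF p⟩
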